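/- All matroids are finite. For a matroid $M$ with ground set $E(M)$ and rank function $r$, and for $X\subseteq E(M)$, let $\lambda_M(X)=r(X)+r(E(M)\setminus X)-r(M)$. A $k$-separation of $M$ is a partition $(X,Y)$ of $E(M)$ with $|X|,|Y|\ge k$ and $\lambda_M(X)<k$, and $M$ is 3-connected if it has no $k$-separation with $k<3$. A triangle is a 3-element circuit, and a triad is a 3-element cocircuit. A fan of $M$ is a sequence $(x_1,\dots,x_k)$, $k\ge 3$, of distinct elements of $E(M)$ such that $\{x_1,x_2,x_3\}$ is a triangle or a triad and, for each $i\in\{1,\dots,k-3\}$, if $\{x_i,x_{i+1},x_{i+2}\}$ is a triangle then $\{x_{i+1},x_{i+2},x_{i+3}\}$ is a triad, and if $\{x_i,x_{i+1},x_{i+2}\}$ is a triad then $\{x_{i+1},x_{i+2},x_{i+3}\}$ is a triangle. A fan is inclusionwise maximal if its set of elements is not properly contained in the set of elements of another fan of $M$. A wheel is a matroid isomorphic to the cycle matroid of a wheel graph with $r\ge 2$ spokes (for $r=2$ the two rim edges are parallel), and a whirl is a matroid isomorphic to one obtained from such a cycle matroid by relaxing the rim, that is, by declaring the rim to be a basis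 (so $U_{2,4}$ is a whirl). Let $M$ be a 3-connected matroid that is not a wheel or a whirl, let $N$ be a minor of $M$ without loops or coloops, and let $F=(x_1,x_2,\dots,x_k)$ be an inclusionwise maximal fan of $M$ with $k\ge 4$ elements. If $|E(N)\cap\{x_1,\dots,x_k\}|\le 1$, then at least one of the matroids $M\backslash x_1$, $M/x_1$, $M\backslash x_k$, $M/x_k$ is 3-connected and has $N$ as a minor. -/

import Mathlib

open Set

namespace Matroid

variable {α : Type*}

/-- The connectivity function `λ_M(X) = r(X) + r(E - X) - r(M)`. For a finite matroid all three
ranks are finite, and submodularity of the rank shows that the subtraction is not truncated. -/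
noncomputable def conn (M : Matroid α) (X : Set α) : ℕ∞ :=
  M.eRk X + M.eRk (M.E \ X) - M.eRank

/-- `(X, Y)` is a `k`-separation of `M`. -/
def IsSeparation (M : Matroid α) (k : ℕ) (X Y : Set α) : Prop :=
  X ∪ Y = M.E ∧ Disjoint X Y ∧ (k : ℕ∞) ≤ X.encard ∧ (k : ℕ∞) ≤ Y.encard ∧ M.conn X < k

/-- `M` is `k`-connected: it has no `k'`-separation with `k' < k`. -/
def IsKConnected (M : Matroid α) (k : ℕ) : Prop :=
  ∀ k' < k, ∀ X Y : Set α, ¬ M.IsSeparation k' X Y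

/-- A triangle is a three-element circuit. -/
def IsTriangle (M : Matroid α) (T : Set α) : Prop :=
  M.IsCircuit T ∧ T.encard = 3

/-- A triad is a triangle of the dual. -/
def IsTriad (M : Matroid α) (T : Set α) : Prop :=
  M✶.IsTriangle T

/-- The set of the three consecutive entries of `x` that start at position `i` (counted from `0`). -/
def consecutiveTriple {k : ℕ} (x : Fin k → α) (i : ℕ) (h : i + 2 < k) : Set α :=
  {x ⟨i, by omega⟩, x ⟨i + 1, by omega⟩, x ⟨i + 2, h⟩}

/-- The sequence `x` of `k ≥ 3` distinct elements is a fan of `M`: the first three elements form a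
triangle or a triad, and from then on the consecutive triples alternate between triangles and
triads. -/
structure IsFan (M : Matroid α) {k : ℕ} (x : Fin k → α) : Prop where
  three_le : 3 ≤ k
  injective : Function.Injective x
  mem_ground : ∀ i, x i ∈ M.E
  first : M.IsTriangle (consecutiveTriple x 0 three_le) ∨
    M.IsTriad (consecutiveTriple x 0 three_le)
  triad_of_triangle : ∀ (i : ℕ) (h : i + 3 < k),
    M.IsTriangle (consecutiveTriple x i (by omega)) → M.IsTriad (consecutiveTriple x (i + 1) h)
  triangle_of_triad : ∀ (i : ℕ) (h : i + 3 < k),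
    M.IsTriad (consecutiveTriple x i (by omega)) → M.IsTriangle (consecutiveTriple x (i + 1) h)

/-- A fan is (inclusionwise) maximal if its set of elements is not properly contained in the set of
elements of another fan. -/
def IsMaximalFan (M : Matroid α) {k : ℕ} (x : Fin k → α) : Prop :=
  M.IsFan x ∧ ∀ (m : ℕ) (y : Fin m → α), M.IsFan y → range x ⊆ range y → range y = range x

/-- In the multigraph with vertex set `V`, edge set `ε` and end map `ends`, the set `C` is the edge
set of a cycle: it can be listed as `e₀, …, eₙ₋₁` (`n ≥ 1`, distinct edges) along distinct vertices
`v₀, …, vₙ₋₁` so that `eᵢ` joins `vᵢ` and `vᵢ₊₁`, indices modulo `n`. -/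
def IsCycleEdgeSet {V ε : Type*} (ends : ε → Sym2 V) (C : Set ε) : Prop :=
  ∃ n : ℕ, 0 < n ∧ ∃ (v : ZMod n → V) (e : ZMod n → ε),
    Function.Injective v ∧ Function.Injective e ∧ range e = C ∧
      ∀ i, ends (e i) = s(v i, v (i + 1))

/-- A set of edges of a multigraph is a forest, that is, independent in the cycle matroid, if it
contains the edge set of no cycle. -/
def IsForest {V ε : Type*} (ends : ε → Sym2 V) (X : Set ε) : Prop :=
  ∀ C ⊆ X, ¬ IsCycleEdgeSet ends C

/-- The ends of the edges of the wheel graph with `r` spokes. The vertices are the hub `none` and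
the rim vertices `some i`; the edge `Sum.inl i` is the spoke from the hub to `some i`, and the edge
`Sum.inr i` is the rim edge from `some i` to `some (i + 1)`, indices modulo `r`. For `r = 2` the two
rim edges are parallel. -/
def wheelEnds (r : ℕ) : ZMod r ⊕ ZMod r → Sym2 (Option (ZMod r))
  | Sum.inl i => s(none, some i)
  | Sum.inr i => s(some i, some (i + 1))

/-- `M` is a wheel: it is isomorphic to the cycle matroid of a wheel graph. -/
def IsWheel (M : Matroid α) : Prop :=
  ∃ r : ℕ, 2 ≤ r ∧ ∃ φ : ZMod r ⊕ ZMod r → α, Function.Injective φ ∧ range φ = M.E ∧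
    ∀ X, M.Indep (φ '' X) ↔ IsForest (wheelEnds r) X

/-- `M` is a whirl: it is isomorphic to the matroid obtained from the cycle matroid of a wheel graph
by relaxing the rim, that is, by making the rim a basis. -/
def IsWhirl (M : Matroid α) : Prop :=
  ∃ r : ℕ, 2 ≤ r ∧ ∃ φ : ZMod r ⊕ ZMod r → α, Function.Injective φ ∧ range φ = M.E ∧
    ∀ X, M.Indep (φ '' X) ↔ (IsForest (wheelEnds r) X ∨ X = range Sum.inr)

end Matroid

/-! Under the hypotheses, removing either end of the fan in the appropriate way (deletion if the end
triple is a triangle, contraction if it is a triad) keeps 3-connectedness; the minor `N` only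
decides which end to use. By duality it suffices to treat fans that begin with a triangle
(`IsAltFan`).

Connectivity (`IsAltFan.delete_first_isKConnected`): a 2-separation of `M ＼ {x 0}` must split `x 1`
from `x 2`, since otherwise `x 0` could be added to one side. The triad `{x 1, x 2, x 3}` then
forces a further triad through `x 0` and one of `x 1`, `x 2`. This reduces to a triad `{z, x 0, x
1}`. Maximality puts `z` into the fan, and orthogonality (a circuit and a cocircuit never share
exactly one element) leaves only the last element of a fan of even length. A rank count shows that
such a fan is all of `M.E` and closes up cyclically. By `IsCyclicFan.isWheel_or_isWhirl`, a cyclic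
fan determines every independent set except for whether the rim is independent, so `M` is a wheel or
a whirl.

Minor (`IsAltFan.isMinor_delete_first`): if `N` avoids `x 0`, `x 1`, `x 2`, exchanging parallel and
series elements gives `N ≤m M ＼ {x 0}`. If the first end fails, the only element of `N` in the fan
is among the first three, and the same argument applies at the other end. The exceptions have length
four or five with that element in the middle; there the exchange at the first end has already given
`N ≤m M ／ {x 3}`, which handles the last element. -/

namespace Matroid

variable {α : Type*}

/-! ### Natural-number rank of a finite matroid -/

/-- The rank of a set as a natural number. -/
noncomputable def rk (M : Matroid α) (X : Set α) : ℕ := (M.eRk X).toNat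

lemma cast_rk (M : Matroid α) [M.Finite] (X : Set α) : (M.rk X : ℕ∞) = M.eRk X :=
  ENat.natCast_toNat (((M.eRk_le_eRank X).trans M.eRank_le_encard_ground).trans_lt
    M.ground_finite.encard_lt_top).ne

lemma rk_mono (M : Matroid α) [M.Finite] {X Y : Set α} (h : X ⊆ Y) : M.rk X ≤ M.rk Y := by
  have := M.eRk_mono h
  rw [← cast_rk, ← cast_rk] at this
  exact_mod_cast this

lemma rk_insert_le (M : Matroid α) [M.Finite] (e : α) (X : Set α) :
    M.rk (insert e X) ≤ M.rk X + 1 := by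
  have := M.eRk_insert_le_add_one e X
  rw [← cast_rk, ← cast_rk] at this
  exact_mod_cast this

lemma rk_union_le (M : Matroid α) [M.Finite] (X Y : Set α) :
    M.rk (X ∪ Y) ≤ M.rk X + M.rk Y := by
  have := M.eRk_union_le_eRk_add_eRk X Y
  simp only [← cast_rk] at this
  exact_mod_cast this

lemma rk_le_ncard (M : Matroid α) [M.Finite] {X : Set α} (hX : X.Finite) :
    M.rk X ≤ X.ncard := by
  have := M.eRk_le_encard X
  rw [← cast_rk, ← hX.cast_ncard_eq] at this
  exact_mod_cast this

lemma rk_le_of_subset_closure (M : Matroid α) [M.Finite] {X Y : Set α} (h : X ⊆ M.closure Y) :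
    M.rk X ≤ M.rk Y := by
  have := M.eRk_mono h
  rw [eRk_closure_eq, ← cast_rk, ← cast_rk] at this
  exact_mod_cast this

lemma rk_insert_of_mem_closure (M : Matroid α) [M.Finite] {e : α} {X : Set α}
    (h : e ∈ M.closure X) : M.rk (insert e X) = M.rk X := by
  rw [rk, rk, ← eRk_closure_eq, closure_insert_eq_of_mem_closure h, eRk_closure_eq]

lemma rk_insert_of_notMem_closure (M : Matroid α) [M.Finite] {e : α} {X : Set α}
    (he : e ∈ M.E) (h : e ∉ M.closure X) : M.rk (insert e X) = M.rk X + 1 := by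
  have := eRk_insert_eq_add_one ⟨he, h⟩
  simp only [← cast_rk] at this
  exact_mod_cast this

lemma indep_iff_rk_eq (M : Matroid α) [M.Finite] {X : Set α} (hX : X.Finite) :
    M.Indep X ↔ M.rk X = X.ncard := by
  rw [indep_iff_eRk_eq_encard_of_finite hX, ← cast_rk, ← hX.cast_ncard_eq, Nat.cast_inj]

lemma rk_dual (M : Matroid α) [M.Finite] {X : Set α} (hX : X ⊆ M.E) :
    M✶.rk X + M.rk M.E = M.rk (M.E \ X) + X.ncard := by
  have := M.eRk_dual_add_eRank X hX
  rw [← eRk_ground, ← cast_rk, ← cast_rk, ← cast_rk,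
    ← (M.ground_finite.subset hX).cast_ncard_eq] at this
  exact_mod_cast this

lemma rk_compl_lt_of_dual_dep (M : Matroid α) [M.Finite] {X : Set α} (hX : M✶.Dep X) :
    M.rk (M.E \ X) < M.rk M.E := by
  have hXE : X ⊆ M.E := hX.subset_ground
  have h1 := M.rk_dual hXE
  have hfin := M.ground_finite.subset hXE
  have h2 := M✶.rk_le_ncard hfin
  have h3 : M✶.rk X ≠ X.ncard := fun h ↦ hX.not_indep ((M✶.indep_iff_rk_eq hfin).2 h)
  omega

/-! ### Connectivity -/

lemma ground_rk_le (M : Matroid α) [M.Finite] (X : Set α) :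
    M.rk M.E ≤ M.rk X + M.rk (M.E \ X) := by
  refine le_trans (M.rk_mono ?_) (M.rk_union_le X (M.E \ X))
  intro e he
  by_cases h : e ∈ X <;> simp [h, he]

/-- The truncated subtraction in `conn` is harmless by `ground_rk_le`, so connectivity becomes
linear arithmetic in natural numbers. -/
lemma conn_lt_iff (M : Matroid α) [M.Finite] (X : Set α) (k : ℕ) :
    M.conn X < k ↔ M.rk X + M.rk (M.E \ X) < M.rk M.E + k := by
  have h := M.ground_rk_le X
  have : M.conn X = ((M.rk X + M.rk (M.E \ X) - M.rk M.E : ℕ) : ℕ∞) := by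
    rw [conn, ← eRk_ground, ← cast_rk, ← cast_rk, ← cast_rk]; norm_cast
  rw [this, Nat.cast_lt]
  omega

lemma conn_dual_lt_iff (M : Matroid α) [M.Finite] {X : Set α} (hX : X ⊆ M.E) (k : ℕ) :
    M✶.conn X < k ↔ M.conn X < k := by
  rw [conn_lt_iff, conn_lt_iff, dual_ground]
  have h1 := M.rk_dual hX
  have h2 := M.rk_dual (X := M.E \ X) sdiff_subset
  have h3 := M.rk_dual (X := M.E) subset_rfl
  rw [sdiff_sdiff_cancel_left hX] at h2
  have h4 := ncard_sdiff_add_ncard_of_subset hX M.ground_finite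
  have h5 : M.rk (M.E \ M.E) = 0 := by simp [rk]
  omega

lemma IsKConnected.dual {M : Matroid α} [M.Finite] {k : ℕ} (h : M.IsKConnected k) :
    M✶.IsKConnected k := by
  rintro k' hk' X Y ⟨h1, h2, h3, h4, h5⟩
  rw [dual_ground] at h1
  exact h k' hk' X Y ⟨h1, h2, h3, h4,
    (M.conn_dual_lt_iff (h1 ▸ subset_union_left) k').1 h5⟩

lemma isKConnected_of_dual {M : Matroid α} [M.Finite] {k : ℕ} (h : M✶.IsKConnected k) :
    M.IsKConnected k := by
  simpa using h.dual

lemma IsKConnected.le_rk_add {M : Matroid α} [M.Finite] (hM : M.IsKConnected 3) {X : Set α}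
    (hX : X ⊆ M.E) (h2 : 2 ≤ X.ncard) (h2' : 2 ≤ (M.E \ X).ncard) :
    M.rk M.E + 2 ≤ M.rk X + M.rk (M.E \ X) := by
  by_contra hcon
  refine hM 2 (by norm_num) X (M.E \ X) ⟨union_sdiff_cancel hX, disjoint_sdiff_right, ?_, ?_, ?_⟩
  · rw [← (M.ground_finite.subset hX).cast_ncard_eq]; exact_mod_cast h2
  · rw [← (M.ground_finite.subset sdiff_subset).cast_ncard_eq]; exact_mod_cast h2'
  · rw [conn_lt_iff]; omega

/-- Enlarge the set to a pair `Y`. At least two elements remain outside, so `r(Y) + r(E - Y) ≥ r(M)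
+ 2`, and `r(E - Y) ≤ r(M)` forces `r(Y) = 2`. -/
lemma IsKConnected.indep_of_ncard_le_two {M : Matroid α} [M.Finite] (hM : M.IsKConnected 3)
    (hE : 4 ≤ M.E.ncard) {X : Set α} (hX : X ⊆ M.E) (h2 : X.ncard ≤ 2) : M.Indep X := by
  obtain ⟨Y, hXY, hYE, hY⟩ := exists_subsuperset_card_eq (n := 2) hX h2 (by omega)
  refine Indep.subset ?_ hXY
  have hYf := M.ground_finite.subset hYE
  have h1 := ncard_sdiff_add_ncard_of_subset hYE M.ground_finite
  have h3 := hM.le_rk_add hYE hY.ge (by omega)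
  have h4 := M.rk_mono (X := M.E \ Y) sdiff_subset
  have h5 := M.rk_le_ncard hYf
  rw [M.indep_iff_rk_eq hYf]
  omega

lemma IsKConnected.isTriangle_of_rk_le {M : Matroid α} [M.Finite] (hM : M.IsKConnected 3)
    (hE : 4 ≤ M.E.ncard) {X : Set α} (hX : X ⊆ M.E) (h3 : X.ncard = 3) (hr : M.rk X ≤ 2) :
    M.IsTriangle X := by
  have hXf := M.ground_finite.subset hX
  refine ⟨?_, by rw [← hXf.cast_ncard_eq, h3]; rfl⟩
  rw [isCircuit_iff_forall_ssubset, ← not_indep_iff, M.indep_iff_rk_eq hXf]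
  refine ⟨by omega, fun I hI ↦ hM.indep_of_ncard_le_two hE (hI.subset.trans hX) ?_⟩
  have := ncard_lt_ncard hI hXf
  omega

lemma IsKConnected.isTriad_of_rk_lt {M : Matroid α} [M.Finite] (hM : M.IsKConnected 3)
    (hE : 4 ≤ M.E.ncard) {X : Set α} (hX : X ⊆ M.E) (h3 : X.ncard = 3)
    (hr : M.rk (M.E \ X) < M.rk M.E) : M.IsTriad X := by
  refine hM.dual.isTriangle_of_rk_le hE hX h3 ?_
  have := M.rk_dual hX
  omega

lemma IsKConnected.three_le_ncard_of_isCircuit {M : Matroid α} [M.Finite] (hM : M.IsKConnected 3)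
    (hE : 4 ≤ M.E.ncard) {C : Set α} (hC : M.IsCircuit C) : 3 ≤ C.ncard := by
  by_contra h
  exact hC.not_indep (hM.indep_of_ncard_le_two hE hC.subset_ground (by omega))

lemma IsKConnected.mem_closure_sdiff {M : Matroid α} [M.Finite] (hM : M.IsKConnected 3)
    (hE : 4 ≤ M.E.ncard) {e : α} (he : e ∈ M.E) : e ∈ M.closure (M.E \ {e}) := by
  by_contra h
  rw [← isColoop_iff_notMem_closure_compl] at h
  have := hM.dual.indep_of_ncard_le_two hE (X := {e}) (by simpa using he) (by simp)
  exact h.isCocircuit.not_indep this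

/-- A finite matroid without loops, coloops and 2-separations is 3-connected. -/
lemma isKConnected_three_of_forall {M : Matroid α} [M.Finite]
    (h1 : ∀ e ∈ M.E, M.rk M.E < M.rk {e} + M.rk (M.E \ {e}))
    (h2 : ∀ X ⊆ M.E, 2 ≤ X.ncard → 2 ≤ (M.E \ X).ncard →
      M.rk M.E + 2 ≤ M.rk X + M.rk (M.E \ X)) : M.IsKConnected 3 := by
  rintro k hk X Y ⟨hU, hd, hX, hY, hlt⟩
  have hXE : X ⊆ M.E := hU ▸ subset_union_left
  have hYE : Y ⊆ M.E := hU ▸ subset_union_right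
  have hYX : M.E \ X = Y := by rw [← hU, union_sdiff_left, hd.sdiff_eq_right]
  have hXY : M.E \ Y = X := by rw [← hU, union_sdiff_right, hd.sdiff_eq_left]
  rw [conn_lt_iff, hYX] at hlt
  rw [← (M.ground_finite.subset hXE).cast_ncard_eq, Nat.cast_le] at hX
  rw [← (M.ground_finite.subset hYE).cast_ncard_eq, Nat.cast_le] at hY
  have h0 := M.ground_rk_le X
  rw [hYX] at h0
  by_cases hX2 : 2 ≤ X.ncard
  · by_cases hY2 : 2 ≤ Y.ncard
    · have := h2 X hXE hX2 (by rwa [hYX])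
      rw [hYX] at this
      omega
    · obtain ⟨e, rfl⟩ := ncard_eq_one.1 (show Y.ncard = 1 by omega)
      have := h1 e (hYE rfl)
      rw [hXY] at this
      simp only [ncard_singleton] at hY
      omega
  · obtain ⟨e, rfl⟩ := ncard_eq_one.1 (show X.ncard = 1 by omega)
    have := h1 e (hXE rfl)
    rw [hYX] at this
    simp only [ncard_singleton] at hX
    omega

/-! ### Triangles, triads and minors -/

section Minors

variable {M N : Matroid α} {a b c d e : α}

lemma IsMinor.dual (h : N ≤m M) : N✶ ≤m M✶ := by
  obtain ⟨C, D, rfl⟩ := h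
  exact ⟨D \ C, C, by rw [dual_contract_delete, delete_contract_comm']⟩

lemma isMinor_of_dual (h : N✶ ≤m M✶) : N ≤m M := by
  simpa using h.dual

lemma delete_isMinor (M : Matroid α) (D : Set α) : M ＼ D ≤m M := ⟨∅, D, by simp⟩

lemma contract_isMinor (M : Matroid α) (C : Set α) : M ／ C ≤m M := ⟨C, ∅, by simp⟩

lemma IsMinor.delete_or_contract (h : N ≤m M) (he : e ∉ N.E) :
    N ≤m M ＼ {e} ∨ N ≤m M ／ {e} := by
  obtain ⟨C, D, -, -, hCD, rfl⟩ := h.exists_eq_contract_delete_disjoint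
  by_cases heM : e ∈ M.E
  · by_cases heC : e ∈ C
    · refine .inr ⟨C, D, ?_⟩
      rw [contract_contract, singleton_union, insert_eq_of_mem heC]
    · have heD : e ∈ D := by
        by_contra heD
        exact he ⟨⟨heM, heC⟩, heD⟩
      refine .inl ⟨C, D, ?_⟩
      rw [← contract_delete_comm _ (by simpa using heC), delete_delete, singleton_union,
        insert_eq_of_mem heD]
  · left
    rwa [deleteElem_eq_self heM]

lemma IsTriangle.ncard_eq {T : Set α} (h : M.IsTriangle T) : T.ncard = 3 := by
  rw [ncard, h.2]; rfl

lemma IsTriangle.subset_ground {T : Set α} (h : M.IsTriangle T) : T ⊆ M.E := h.1.subset_ground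

lemma IsTriad.subset_ground {T : Set α} (h : M.IsTriad T) : T ⊆ M.E := h.1.subset_ground

lemma IsTriangle.ne (h : M.IsTriangle {a, b, c}) : a ≠ b ∧ a ≠ c ∧ b ≠ c := by
  have := h.ncard_eq
  refine ⟨?_, ?_, ?_⟩ <;> rintro rfl
  · have h2 := ncard_insert_le a {c}
    rw [ncard_singleton] at h2
    simp only [mem_singleton_iff, mem_insert_iff, true_or, insert_eq_of_mem] at this
    omega
  · have h2 := ncard_insert_le b {a}
    rw [ncard_singleton] at h2
    rw [insert_eq_of_mem (by simp)] at this
    omega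
  · have h2 := ncard_insert_le a {b}
    rw [ncard_singleton] at h2
    simp only [mem_singleton_iff, insert_eq_of_mem] at this
    omega

lemma IsTriangle.swap (h : M.IsTriangle {a, b, c}) : M.IsTriangle {b, a, c} := by
  rwa [insert_comm]

lemma IsTriangle.swap_right (h : M.IsTriangle {a, b, c}) : M.IsTriangle {a, c, b} := by
  rwa [pair_comm]

lemma IsTriad.ne (h : M.IsTriad {a, b, c}) : a ≠ b ∧ a ≠ c ∧ b ≠ c := IsTriangle.ne h

lemma IsTriad.swap (h : M.IsTriad {a, b, c}) : M.IsTriad {b, a, c} := IsTriangle.swap h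

lemma IsTriad.swap_right (h : M.IsTriad {a, b, c}) : M.IsTriad {a, c, b} :=
  IsTriangle.swap_right h

lemma IsTriangle.mem_closure (h : M.IsTriangle {a, b, c}) : a ∈ M.closure {b, c} := by
  have := h.1.mem_closure_sdiff_singleton_of_mem (e := a) (by simp)
  rwa [insert_sdiff_self_of_notMem (by simp [h.ne.1, h.ne.2.1])] at this

lemma dual_isTriad {T : Set α} : M✶.IsTriad T ↔ M.IsTriangle T := by
  rw [IsTriad, dual_dual]

lemma IsTriad.contract {T : Set α} (h : M.IsTriad T) (he : e ∉ T) : (M ／ {e}).IsTriad T := by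
  refine ⟨?_, h.2⟩
  rw [dual_contract, delete_isCircuit_iff]
  exact ⟨h.1, by simpa using he⟩

/-- A triangle and a cocircuit do not meet in exactly one element. -/
lemma IsTriangle.inter_isCocircuit_ne {T K : Set α} (hT : M.IsTriangle T) (hK : M✶.IsCircuit K)
    (e : α) : T ∩ K ≠ {e} :=
  hT.1.inter_isCocircuit_ne_singleton hK

/-- Contracting two elements of a triangle makes the third a loop, so both sides equal `M ／ {a, b,
c}`. -/
lemma IsTriangle.contract_delete_eq (h : M.IsTriangle {a, b, c}) :
    M ／ {a, b} ＼ {c} = M ／ {a, c} ＼ {b} := by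
  obtain ⟨hab, hac, hbc⟩ := h.ne
  have h1 : M ／ {a, b} ＼ {c} = M ／ {a, b} ／ {c} := by
    refine (contract_eq_delete_of_subset_loops ?_).symm
    rw [singleton_subset_iff, contract_loops_eq]
    exact ⟨h.swap_right.swap.mem_closure, by simp [hac.symm, hbc.symm]⟩
  have h2 : M ／ {a, c} ＼ {b} = M ／ {a, c} ／ {b} := by
    refine (contract_eq_delete_of_subset_loops ?_).symm
    rw [singleton_subset_iff, contract_loops_eq]
    exact ⟨h.swap.mem_closure, by simp [hab.symm, hbc]⟩
  rw [h1, h2, contract_contract, contract_contract]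
  congr 1
  ext; simp; tauto

/-- In `M ／ {a}` the elements `b` and `c` are parallel. If `b` is contracted, `c` becomes a loop,
hence is not in `N`, and the roles of `b` and `c` can be exchanged. -/
lemma IsTriangle.isMinor_contract_delete (hT : M.IsTriangle {a, b, c}) (hN : N ≤m M ／ {a})
    (hb : b ∉ N.E) (hl : ∀ e, ¬ N.IsLoop e) : N ≤m M ／ {a} ＼ {b} := by
  obtain ⟨hab, hac, hbc⟩ := hT.ne
  obtain h | h := hN.delete_or_contract hb
  · exact h
  rw [contract_contract, singleton_union] at h
  have hc : c ∉ N.E := fun hc ↦ hl c <| by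
    refine IsLoop.of_isMinor ?_ hc h
    rw [contract_isLoop_iff_mem_closure]
    exact ⟨hT.swap_right.swap.mem_closure, by simp [hac.symm, hbc.symm]⟩
  have h' : N ≤m M ／ {a, b} ＼ {c} := by
    obtain h | h' := h.delete_or_contract hc
    · exact h
    rwa [contract_eq_delete_of_subset_loops] at h'
    rw [singleton_subset_iff, contract_loops_eq]
    exact ⟨hT.swap_right.swap.mem_closure, by simp [hac.symm, hbc.symm]⟩
  rw [hT.contract_delete_eq, ← singleton_union, ← contract_contract,
    contract_delete_comm _ (by simpa using hbc.symm)] at h'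
  exact h'.trans (contract_isMinor _ _)

lemma IsTriad.isMinor_delete_contract (hT : M.IsTriad {a, b, c}) (hN : N ≤m M ＼ {a})
    (hb : b ∉ N.E) (hl : ∀ e, ¬ N.IsColoop e) : N ≤m M ＼ {a} ／ {b} := by
  apply isMinor_of_dual
  rw [dual_delete_contract]
  refine IsTriangle.isMinor_contract_delete hT ?_ hb (by simpa using hl)
  simpa using hN.dual

/-- If `a` is contracted, then `b` may be deleted (parallel to `c`), after which `c` may be
contracted (in series with `d`). Now `M ／ {a, c} ＼ {b} = M ／ {c, b} ＼ {a}`, in which `a` is deleted.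
-/
lemma isMinor_delete_of_triangle_triad (hT : M.IsTriangle {a, b, c}) (hK : M.IsTriad {b, c, d})
    (had : a ≠ d) (hN : N ≤m M) (hl : ∀ e, ¬ N.IsLoop e) (hcl : ∀ e, ¬ N.IsColoop e)
    (ha : a ∉ N.E) (hb : b ∉ N.E) (hc : c ∉ N.E) : N ≤m M ＼ {a} := by
  obtain ⟨hab, hac, hbc⟩ := hT.ne
  obtain h | h := hN.delete_or_contract ha
  · exact h
  have h1 := hT.isMinor_contract_delete h hb hl
  have h2 := (hK.contract (e := a) (by simp [hab, hac, had])).isMinor_delete_contract h1 hc hcl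
  rw [contract_delete_contract _ _ _ _ (by simpa using hbc.symm), singleton_union, pair_comm,
    hT.swap_right.swap.contract_delete_eq, contract_delete_comm _
    (by simp [hac, hab])] at h2
  exact h2.trans (contract_isMinor _ _)

lemma isMinor_contract_of_triangle_triad (hT : M.IsTriangle {a, b, c}) (hK : M.IsTriad {b, c, d})
    (had : a ≠ d) (hN : N ≤m M) (hl : ∀ e, ¬ N.IsLoop e) (hcl : ∀ e, ¬ N.IsColoop e)
    (ha : a ∉ N.E) (hb : b ∉ N.E) (hd : d ∉ N.E) : N ≤m M ＼ {a} ∨ N ≤m M ／ {d} := by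
  obtain ⟨hab, hac, hbc⟩ := hT.ne
  obtain h | h := hN.delete_or_contract ha
  · exact .inl h
  have h1 := hT.isMinor_contract_delete h hb hl
  have h2 := (hK.contract (e := a)
    (by simp [hab, hac, had])).swap_right.isMinor_delete_contract h1 hd hcl
  rw [contract_delete_contract _ _ _ _ (by simpa using hK.ne.2.1.symm), union_comm,
    ← contract_contract] at h2
  exact .inr ((h2.trans (delete_isMinor _ _)).trans (contract_isMinor _ _))

end Minors

/-! ### Cycles of wheel graphs -/

section Wheel

variable {r : ℕ}

/-- `C` contains two distinct spokes of the wheel graph together with a rim path joining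
their ends. -/
def HasSpokeCycle (C : Set (ZMod r ⊕ ZMod r)) : Prop :=
  ∃ (i : ZMod r) (m : ℕ), 0 < m ∧ m < r ∧ Sum.inl i ∈ C ∧ Sum.inl (i + m) ∈ C ∧
    ∀ l < m, Sum.inr (i + l) ∈ C

/-- At every rim vertex the set `C` does not have exactly one edge. -/
def NoRimLeaf (C : Set (ZMod r ⊕ ZMod r)) : Prop :=
  ∀ i : ZMod r, (Sum.inr i ∈ C → Sum.inl (i + 1) ∈ C ∨ Sum.inr (i + 1) ∈ C) ∧
    (Sum.inl (i + 1) ∈ C → Sum.inr i ∈ C ∨ Sum.inr (i + 1) ∈ C) ∧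
    (Sum.inr (i + 1) ∈ C → Sum.inr i ∈ C ∨ Sum.inl (i + 1) ∈ C)

lemma HasSpokeCycle.mono {C X : Set (ZMod r ⊕ ZMod r)} (h : HasSpokeCycle C) (hCX : C ⊆ X) :
    HasSpokeCycle X := by
  obtain ⟨i, m, h0, h1, h2, h3, h4⟩ := h
  exact ⟨i, m, h0, h1, hCX h2, hCX h3, fun l hl ↦ hCX (h4 l hl)⟩

/-- From a spoke in `C`, follow rim edges of `C` in a direction in which one exists. Either the
whole rim is traversed, or at the first missing rim edge the absence of a leaf supplies a second
spoke. Without spokes the walk never stops. -/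
lemma NoRimLeaf.rim_subset_or_hasSpokeCycle [NeZero r] {C : Set (ZMod r ⊕ ZMod r)}
    (h : NoRimLeaf C) (hC : C.Nonempty) : range Sum.inr ⊆ C ∨ HasSpokeCycle C := by
  classical
  have hr : 0 < r := Nat.pos_of_ne_zero (NeZero.ne r)
  have hcover : ∀ i j : ZMod r, ∃ l : ℕ, j = i + l := fun i j ↦ ⟨(j - i).val, by simp⟩
  by_cases hs : ∃ i : ZMod r, Sum.inl i ∈ C
  · obtain ⟨i, hi⟩ := hs
    have hi' := (h (i - 1)).2.1
    rw [sub_add_cancel] at hi'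
    obtain hprev | hnext := hi' hi
    · by_cases hall : ∀ l : ℕ, Sum.inr (i - 1 - l) ∈ C
      · left
        rintro _ ⟨j, rfl⟩
        obtain ⟨l, hl⟩ := hcover j (i - 1)
        rw [show j = i - 1 - l by rw [hl]; ring]
        exact hall l
      push Not at hall
      obtain ⟨l, hl, hmin⟩ : ∃ l : ℕ, Sum.inr (i - 1 - l) ∉ C ∧
          ∀ l' < l, Sum.inr (i - 1 - l') ∈ C :=
        ⟨Nat.find hall, Nat.find_spec hall, fun l' hl' ↦ not_not.1 (Nat.find_min hall hl')⟩
      have hl0 : 0 < l := by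
        rcases Nat.eq_zero_or_pos l with rfl | h0
        · simp [hprev] at hl
        · exact h0
      -- Rim positions are periodic modulo `r`, so the first missing edge occurs within one turn.
      have hlr : l < r := by
        by_contra hcon
        have := hmin (l - r) (by omega)
        rw [Nat.cast_sub (by omega)] at this
        simp at this
        exact hl this
      right
      refine ⟨i - l, l, hl0, hlr, ?_, by simpa using hi, fun l' hl' ↦ ?_⟩
      · have h1 := (h (i - 1 - l)).2.2
        rw [show i - 1 - l + 1 = i - l by ring] at h1
        refine (h1 ?_).resolve_left hl
        have h2 := hmin (l - 1) (by omega)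
        rwa [Nat.cast_sub (by omega), show i - 1 - ((l : ZMod r) - (1 : ℕ)) = i - l by
          push_cast; ring] at h2
      · have h2 := hmin (l - 1 - l') (by omega)
        rwa [Nat.cast_sub (by omega), Nat.cast_sub (by omega),
          show i - 1 - ((l : ZMod r) - (1 : ℕ) - l') = i - l + l' by push_cast; ring] at h2
    · by_cases hall : ∀ l : ℕ, Sum.inr (i + l) ∈ C
      · left
        rintro _ ⟨j, rfl⟩
        obtain ⟨l, rfl⟩ := hcover i j
        exact hall l
      push Not at hall
      obtain ⟨l, hl, hmin⟩ : ∃ l : ℕ, Sum.inr (i + l) ∉ C ∧ ∀ l' < l, Sum.inr (i + l') ∈ C :=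
        ⟨Nat.find hall, Nat.find_spec hall, fun l' hl' ↦ not_not.1 (Nat.find_min hall hl')⟩
      have hl0 : 0 < l := by
        rcases Nat.eq_zero_or_pos l with rfl | h0
        · simp [hnext] at hl
        · exact h0
      have hlr : l < r := by
        by_contra hcon
        have := hmin (l - r) (by omega)
        rw [Nat.cast_sub (by omega)] at this
        simp at this
        exact hl this
      right
      refine ⟨i, l, hl0, hlr, hi, ?_, hmin⟩
      have h1 := (h (i + (l - 1 : ℕ))).1 (hmin _ (by omega))
      rw [Nat.cast_sub (by omega), show i + ((l : ZMod r) - (1 : ℕ)) + 1 = i + l by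
        push_cast; ring] at h1
      exact h1.resolve_right hl
  · push Not at hs
    obtain ⟨i | i, hi⟩ := hC
    · exact (hs i hi).elim
    have hall : ∀ l : ℕ, Sum.inr (i + l) ∈ C := by
      intro l
      induction l with
      | zero => simpa using hi
      | succ l ih =>
        have := ((h _).1 ih).resolve_left (hs _)
        rwa [add_assoc, ← Nat.cast_succ] at this
    left
    rintro _ ⟨j, rfl⟩
    obtain ⟨l, rfl⟩ := hcover i j
    exact hall l

lemma isCycleEdgeSet_rim (hr : 2 ≤ r) : IsCycleEdgeSet (wheelEnds r) (range Sum.inr) :=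
  ⟨r, by omega, some, Sum.inr, Option.some_injective _, Sum.inr_injective, rfl, fun _ ↦ rfl⟩

lemma HasSpokeCycle.exists_isCycleEdgeSet {X : Set (ZMod r ⊕ ZMod r)} (h : HasSpokeCycle X) :
    ∃ C ⊆ X, IsCycleEdgeSet (wheelEnds r) C := by
  obtain ⟨i, m, hm0, hmr, hi, him, hl⟩ := h
  have hinj : ∀ a b : ℕ, a < r → b < r → (i + a : ZMod r) = i + b → a = b := by
    intro a b ha hb hab
    rw [add_right_inj, ZMod.natCast_eq_natCast_iff'] at hab
    rwa [Nat.mod_eq_of_lt ha, Nat.mod_eq_of_lt hb] at hab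
  -- The cycle has `m + 2` edges: position `0` is the hub, position `j > 0` the rim vertex `i + (j -
  -- 1)`; edges `0` and `m + 1` are the two spokes. `Fin (m + 2)` is `ZMod (m + 2)` by definition.
  let v : Fin (m + 2) → Option (ZMod r) := fun j ↦
    if j.val = 0 then none else some (i + (j.val - 1 : ℕ))
  let e : Fin (m + 2) → ZMod r ⊕ ZMod r := fun j ↦
    if j.val = 0 then Sum.inl i else if j.val = m + 1 then Sum.inl (i + m)
      else Sum.inr (i + (j.val - 1 : ℕ))
  have hends : ∀ j : Fin (m + 2), wheelEnds r (e j) = s(v j, v (j + 1)) := by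
    intro j
    have hj := j.2
    by_cases h1 : j.val = m + 1
    · have hj1 : (j + 1).val = 0 := by
        have : j = Fin.last (m + 1) := Fin.ext h1
        rw [this]; exact congrArg Fin.val (Fin.last_add_one (m + 1))
      simp only [v, e, hj1, h1]
      simp [wheelEnds, Sym2.eq_swap]
    · have hj1 : (j + 1).val = j.val + 1 :=
        Fin.val_add_one_of_lt (Fin.lt_def.2 (by simp only [Fin.val_last]; omega))
      simp only [v, e, hj1, h1]
      by_cases h0 : j.val = 0
      · simp [h0, wheelEnds]
      · simp only [h0, if_false, wheelEnds]
        rw [if_neg (by omega)]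
        rw [add_assoc, ← Nat.cast_succ, show (j.val - 1).succ = j.val + 1 - 1 by omega]
  refine ⟨range e, ?_, m + 2, by omega, v, e, ?_, ?_, rfl, ?_⟩
  · rintro _ ⟨j, rfl⟩
    have := j.2
    simp only [e]
    split_ifs
    · exact hi
    · exact him
    · exact hl _ (by omega)
  · intro a b hab
    have ha := a.2
    have hb := b.2
    simp only [v] at hab
    apply Fin.ext
    split_ifs at hab with h1 h2 h2
    · omega
    · have := hinj _ _ (by omega) (by omega) (Option.some_injective _ hab)
      omega
  · intro a b hab
    have ha := a.2
    have hb := b.2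
    simp only [e] at hab
    have h0 : (i : ZMod r) = i + m → False := fun h ↦ by
      have := hinj 0 m (by omega) hmr (by simpa using h)
      omega
    apply Fin.ext
    split_ifs at hab with h1 h2 h3 h4 h5 h6 h7
    · omega
    · exact (h0 (Sum.inl_injective hab)).elim
    · exact (h0 (Sum.inl_injective hab).symm).elim
    · omega
    · have := hinj _ _ (by omega) (by omega) (Sum.inr_injective hab)
      omega
  · exact hends

lemma mem_wheelEnds_iff {i : ZMod r} {f : ZMod r ⊕ ZMod r} :
    some (i + 1) ∈ wheelEnds r f ↔
      f = Sum.inr i ∨ f = Sum.inl (i + 1) ∨ f = Sum.inr (i + 1) := by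
  rcases f with j | j
  · simp [wheelEnds, eq_comm]
  · simp [wheelEnds, eq_comm, or_comm]

lemma wheelEnds_not_isDiag (hr : 2 ≤ r) (f : ZMod r ⊕ ZMod r) : ¬ (wheelEnds r f).IsDiag := by
  have : Fact (1 < r) := ⟨hr⟩
  rcases f with j | j <;> simp [wheelEnds]

/-- A wheel graph has no loop edges, so a cycle has length at least two and each of its edges is
followed, at either end, by a different edge. -/
lemma IsCycleEdgeSet.noRimLeaf (hr : 2 ≤ r) {C : Set (ZMod r ⊕ ZMod r)}
    (h : IsCycleEdgeSet (wheelEnds r) C) : C.Nonempty ∧ NoRimLeaf C := by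
  obtain ⟨n, hn, v, e, hv, he, rfl, hends⟩ := h
  refine ⟨range_nonempty _, ?_⟩
  have hn1 : n ≠ 1 := by
    rintro rfl
    refine wheelEnds_not_isDiag hr (e 0) ?_
    rw [hends, Subsingleton.elim (0 + 1 : ZMod 1) 0]
    simp
  have : Fact (1 < n) := ⟨by omega⟩
  have key : ∀ w, ∀ f ∈ range e, w ∈ wheelEnds r f → ∃ g ∈ range e, g ≠ f ∧ w ∈ wheelEnds r g := by
    rintro w _ ⟨j, rfl⟩ hw
    rw [hends, Sym2.mem_iff] at hw
    obtain rfl | rfl := hw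
    · refine ⟨e (j - 1), ⟨_, rfl⟩, fun h ↦ ?_, ?_⟩
      · simpa using he h
      · rw [hends]; simp
    · refine ⟨e (j + 1), ⟨_, rfl⟩, fun h ↦ ?_, ?_⟩
      · simpa using he h
      · rw [hends]; simp
  intro i
  refine ⟨fun h ↦ ?_, fun h ↦ ?_, fun h ↦ ?_⟩ <;>
  · obtain ⟨g, hg, hgf, hgw⟩ := key (some (i + 1)) _ h (by simp [mem_wheelEnds_iff])
    rw [mem_wheelEnds_iff] at hgw
    obtain rfl | rfl | rfl := hgw <;> simp_all

lemma isForest_wheelEnds_iff (hr : 2 ≤ r) {X : Set (ZMod r ⊕ ZMod r)} :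
    IsForest (wheelEnds r) X ↔ ¬ range Sum.inr ⊆ X ∧ ¬ HasSpokeCycle X := by
  have : NeZero r := ⟨by omega⟩
  refine ⟨fun h ↦ ⟨fun hX ↦ h _ hX (isCycleEdgeSet_rim hr), fun hX ↦ ?_⟩, fun h C hCX hC ↦ ?_⟩
  · obtain ⟨C, hCX, hC⟩ := hX.exists_isCycleEdgeSet
    exact h C hCX hC
  · obtain ⟨hne, hleaf⟩ := hC.noRimLeaf hr
    obtain h' | h' := hleaf.rim_subset_or_hasSpokeCycle hne
    · exact h.1 (h'.trans hCX)
    · exact h.2 (h'.mono hCX)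

end Wheel

/-! ### Matroids whose ground set is a cyclic fan -/

/-- The elements of `M` are arranged cyclically as spokes `φ (inl i)` and rim elements
`φ (inr i)` so that the consecutive triples are alternately triangles and triads. -/
structure IsCyclicFan (M : Matroid α) (r : ℕ) (φ : ZMod r ⊕ ZMod r → α) : Prop where
  two_le : 2 ≤ r
  injective : Function.Injective φ
  range_eq : range φ = M.E
  isTriangle : ∀ i, M.IsTriangle {φ (.inl i), φ (.inr i), φ (.inl (i + 1))}
  isTriad : ∀ i, M.IsTriad {φ (.inr i), φ (.inl (i + 1)), φ (.inr (i + 1))}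

namespace IsCyclicFan

variable {M : Matroid α} {r : ℕ} {φ : ZMod r ⊕ ZMod r → α}

/-- Spokes and rim change places. The shift by one is needed because spoke `i + 1` is the one
between rim elements `i` and `i + 1`. -/
lemma dual (h : M.IsCyclicFan r φ) :
    M✶.IsCyclicFan r (Sum.elim (fun i ↦ φ (.inr i)) (fun i ↦ φ (.inl (i + 1)))) where
  two_le := h.two_le
  injective := by
    rintro (i | i) (j | j) hij <;> simpa using h.injective hij
  range_eq := by
    rw [dual_ground, ← h.range_eq]
    ext x
    constructor
    · rintro ⟨i | i, rfl⟩ <;> simp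
    · rintro ⟨i | i, rfl⟩
      · exact ⟨.inr (i - 1), by simp⟩
      · exact ⟨.inl i, by simp⟩
  isTriangle i := h.isTriad i
  isTriad i := by
    rw [dual_isTriad]
    exact h.isTriangle (i + 1)

/-- Orthogonality with the triads, which are the edge sets at the rim vertices. -/
lemma noRimLeaf_of_isCircuit (h : M.IsCyclicFan r φ) {C : Set α} (hC : M.IsCircuit C) :
    NoRimLeaf (φ ⁻¹' C) := by
  intro i
  have hK := hC.inter_isCocircuit_ne_singleton (h.isTriad i).1 (e := φ (.inr i))
  have hK' := hC.inter_isCocircuit_ne_singleton (h.isTriad i).1 (e := φ (.inl (i + 1)))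
  have hK'' := hC.inter_isCocircuit_ne_singleton (h.isTriad i).1 (e := φ (.inr (i + 1)))
  simp only [mem_preimage]
  refine ⟨fun h1 ↦ ?_, fun h1 ↦ ?_, fun h1 ↦ ?_⟩ <;> by_contra! hcon
  · refine hK (subset_antisymm ?_ (by simp [h1]))
    rintro x ⟨hx, rfl | rfl | rfl⟩ <;> simp_all
  · refine hK' (subset_antisymm ?_ (by simp [h1]))
    rintro x ⟨hx, rfl | rfl | rfl⟩ <;> simp_all
  · refine hK'' (subset_antisymm ?_ (by simp [h1]))
    rintro x ⟨hx, rfl | rfl | rfl⟩ <;> simp_all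

lemma rim_subset_or_hasSpokeCycle (h : M.IsCyclicFan r φ) {X : Set (ZMod r ⊕ ZMod r)}
    (hX : ¬ M.Indep (φ '' X)) : range Sum.inr ⊆ X ∨ HasSpokeCycle X := by
  have : NeZero r := ⟨by have := h.two_le; omega⟩
  have hXE : φ '' X ⊆ M.E := by rw [← h.range_eq]; exact image_subset_range _ _
  rw [not_indep_iff] at hX
  obtain ⟨C, hCX, hC⟩ := hX.exists_isCircuit_subset
  have hsub : φ ⁻¹' C ⊆ X := (preimage_mono hCX).trans (preimage_image_eq X h.injective).subset
  have hne : (φ ⁻¹' C).Nonempty := by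
    obtain ⟨x, hx⟩ := hC.nonempty
    obtain ⟨y, -, rfl⟩ := hCX hx
    exact ⟨y, hx⟩
  obtain h' | h' := (h.noRimLeaf_of_isCircuit hC).rim_subset_or_hasSpokeCycle hne
  · exact .inl (h'.trans hsub)
  · exact .inr (h'.mono hsub)

/-- Going along the rim path, each triangle puts the next spoke into the closure of the previous
spoke and a rim element, so the last spoke is spanned by the rest of `X`. -/
lemma not_indep_of_hasSpokeCycle (h : M.IsCyclicFan r φ) {X : Set (ZMod r ⊕ ZMod r)}
    (hX : HasSpokeCycle X) : ¬ M.Indep (φ '' X) := by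
  obtain ⟨i, m, hm0, hmr, hi, him, hl⟩ := hX
  have hcl : ∀ n ≤ m, φ (.inl (i + n)) ∈ M.closure (φ '' (X \ {.inl (i + m)})) := by
    intro n hn
    have hsub : φ '' (X \ {.inl (i + m)}) ⊆ M.E := by
      rw [← h.range_eq]; exact image_subset_range _ _
    induction n with
    | zero =>
      refine M.subset_closure _ hsub ⟨_, ⟨by simpa using hi, ?_⟩, rfl⟩
      simp only [mem_singleton_iff, Sum.inl.injEq, add_right_inj]
      rw [ZMod.natCast_eq_natCast_iff', Nat.mod_eq_of_lt hmr, Nat.zero_mod]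
      omega
    | succ n ih =>
      have h1 := (h.isTriangle (i + n)).swap_right.swap.mem_closure
      rw [add_assoc, ← Nat.cast_succ] at h1
      refine M.closure_subset_closure_of_subset_closure ?_ h1
      rintro x (rfl | rfl)
      · exact ih (by omega)
      · exact M.subset_closure _ hsub ⟨_, ⟨hl n (by omega), by simp⟩, rfl⟩
  intro hind
  have hmem := hcl m le_rfl
  rw [image_sdiff h.injective, image_singleton] at hmem
  exact hind.notMem_closure_sdiff_of_mem ⟨_, him, rfl⟩ hmem

/-- The spokes span, and there are as many of them as rim elements. Hence an independent rim is the
only independent set that contains the rim, as in a whirl. -/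
lemma isBase_rim [M.Finite] (h : M.IsCyclicFan r φ) (hI : M.Indep (φ '' range Sum.inr)) :
    M.IsBase (φ '' range Sum.inr) := by
  have : NeZero r := ⟨by have := h.two_le; omega⟩
  have hs : M.E ⊆ M.closure (φ '' range Sum.inl) := by
    have hsub : φ '' range Sum.inl ⊆ M.E := by
      rw [← h.range_eq]; exact image_subset_range _ _
    rw [← h.range_eq]
    rintro _ ⟨i | i, rfl⟩
    · exact M.subset_closure _ hsub ⟨_, ⟨i, rfl⟩, rfl⟩
    · refine M.closure_subset_closure ?_ (h.isTriangle i).swap.mem_closure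
      rintro _ (rfl | rfl)
      · exact ⟨_, ⟨i, rfl⟩, rfl⟩
      · exact ⟨_, ⟨i + 1, rfl⟩, rfl⟩
  refine hI.isBase_of_eRk_ge (toFinite _) ?_
  rw [hI.eRk_eq_encard, ← eRk_ground]
  refine (M.eRk_mono hs).trans ?_
  rw [eRk_closure_eq]
  refine (M.eRk_le_encard _).trans ?_
  rw [h.injective.encard_image, h.injective.encard_image, ← image_univ, ← image_univ,
    Sum.inl_injective.encard_image, Sum.inr_injective.encard_image]

theorem isWheel_or_isWhirl [M.Finite] (h : M.IsCyclicFan r φ) : M.IsWheel ∨ M.IsWhirl := by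
  have hforest : ∀ X, IsForest (wheelEnds r) X → M.Indep (φ '' X) := fun X hX ↦ by
    rw [isForest_wheelEnds_iff h.two_le] at hX
    by_contra hcon
    exact (h.rim_subset_or_hasSpokeCycle hcon).elim hX.1 hX.2
  by_cases hrim : M.Indep (φ '' range Sum.inr)
  · right
    refine ⟨r, h.two_le, φ, h.injective, h.range_eq, fun X ↦ ⟨fun hX ↦ ?_, ?_⟩⟩
    · rw [isForest_wheelEnds_iff h.two_le]
      by_cases hrX : range Sum.inr ⊆ X
      · right
        exact (image_injective.2 h.injective
          ((h.isBase_rim hrim).eq_of_subset_indep hX (image_mono hrX))).symm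
      · exact .inl ⟨hrX, fun hs ↦ h.not_indep_of_hasSpokeCycle hs hX⟩
    · rintro (hX | rfl)
      · exact hforest X hX
      · exact hrim
  · left
    refine ⟨r, h.two_le, φ, h.injective, h.range_eq, fun X ↦ ⟨fun hX ↦ ?_, hforest X⟩⟩
    rw [isForest_wheelEnds_iff h.two_le]
    exact ⟨fun hrX ↦ hrim (hX.subset (image_mono hrX)),
      fun hs ↦ h.not_indep_of_hasSpokeCycle hs hX⟩

end IsCyclicFan

/-! ### Deleting the end of a fan -/

section Connectivity

variable {M : Matroid α} {a b c d : α} {X Y : Set α}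

lemma IsTriangle.mem_or_mem {K : Set α} (hT : M.IsTriangle {a, b, c}) (hK : M✶.IsCircuit K)
    (ha : a ∈ K) : b ∈ K ∨ c ∈ K := by
  by_contra! h
  refine hT.inter_isCocircuit_ne hK a (subset_antisymm ?_ (by simp [ha]))
  rintro x ⟨rfl | rfl | rfl, hx⟩
  · rfl
  · exact (h.1 hx).elim
  · exact (h.2 hx).elim

lemma IsTriangle.rk_le [M.Finite] (hT : M.IsTriangle {a, b, c}) : M.rk {a, b, c} ≤ 2 := by
  have h1 : M.rk {a, b, c} ≤ M.rk {b, c} := (M.rk_insert_of_mem_closure hT.mem_closure).le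
  have h2 := M.rk_le_ncard (X := {b, c}) (toFinite _)
  have h3 := ncard_insert_le b {c}
  rw [ncard_singleton] at h3
  omega

lemma IsKConnected.rk_sdiff_of_ncard_le_two [M.Finite] (hM : M.IsKConnected 3)
    (hE : 4 ≤ M.E.ncard) (hX : X ⊆ M.E) (h2 : X.ncard ≤ 2) : M.rk (M.E \ X) = M.rk M.E := by
  have h1 := hM.dual.indep_of_ncard_le_two hE hX h2
  rw [indep_iff_rk_eq _ (M.ground_finite.subset hX)] at h1
  have := M.rk_dual hX
  omega

lemma delete_rk (M : Matroid α) (h : X ⊆ M.E \ {a}) : (M ＼ {a}).rk X = M.rk X := by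
  rw [rk, rk, delete_eq_restrict, restrict_eRk_eq _ h]

lemma sdiff_insert_of_partition (hU : X ∪ Y = M.E \ {a}) (hd : Disjoint X Y) :
    M.E \ insert a X = Y := by
  have h1 : M.E \ insert a X = (M.E \ {a}) \ X := by
    ext; simp; tauto
  rw [h1, ← hU, union_sdiff_left, hd.sdiff_eq_right]

/-- Otherwise `a` is in the closure of `X`, and adding it to `X` gives a 2-separation of `M`. -/
lemma IsKConnected.not_mem_and_mem_of_isTriangle [M.Finite] (hM : M.IsKConnected 3)
    (hT : M.IsTriangle {a, b, c}) (hU : X ∪ Y = M.E \ {a}) (hd : Disjoint X Y)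
    (hX : 2 ≤ X.ncard) (hY : 2 ≤ Y.ncard) (hlt : M.rk X + M.rk Y ≤ M.rk M.E + 1) :
    ¬ (b ∈ X ∧ c ∈ X) := by
  rintro ⟨hb, hc⟩
  have haE : a ∈ M.E := hT.subset_ground (by simp)
  have hXE : X ⊆ M.E := (hU ▸ subset_union_left : X ⊆ M.E \ {a}).trans sdiff_subset
  have hXf := M.ground_finite.subset hXE
  have hcl : a ∈ M.closure X := M.closure_subset_closure (by
    rintro x (rfl | rfl) <;> assumption) hT.mem_closure
  have h1 := hM.le_rk_add (X := insert a X) (insert_subset haE hXE)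
    (hX.trans (ncard_le_ncard (subset_insert _ _) (hXf.insert a)))
    (by rwa [sdiff_insert_of_partition hU hd])
  rw [sdiff_insert_of_partition hU hd, M.rk_insert_of_mem_closure hcl] at h1
  omega

/-- Move `c` over to `X`. The complement of the triad `{b, c, d}` contains `Y \ {c}` but does not
span `c`, so `Y` loses rank and the rank sum does not grow. Now `b` and `c` are on one side, which
is impossible unless only one element `y` is left in `Y \ {c}`; then `X`, the complement of `{a, c,
y}`, is not spanning. -/
lemma IsKConnected.exists_isTriad_of_partition [M.Finite] (hM : M.IsKConnected 3)
    (hE : 4 ≤ M.E.ncard) (hT : M.IsTriangle {a, b, c}) (hK : M.IsTriad {b, c, d})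
    (hU : X ∪ Y = M.E \ {a}) (hd : Disjoint X Y)
    (hY : 2 ≤ Y.ncard) (hlt : M.rk X + M.rk Y ≤ M.rk M.E + 1)
    (hb : b ∈ X) (hc : c ∈ Y) (hdX : d ∈ X) :
    ∃ y ∈ M.E, y ∉ ({a, b, c, d} : Set α) ∧ M.IsTriad {a, c, y} := by
  have haE : a ∈ M.E := hT.subset_ground (by simp)
  have hXa : X ⊆ M.E \ {a} := hU ▸ subset_union_left
  have hYa : Y ⊆ M.E \ {a} := hU ▸ subset_union_right
  have hXE : X ⊆ M.E := hXa.trans sdiff_subset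
  have hYE : Y ⊆ M.E := hYa.trans sdiff_subset
  have hXf := M.ground_finite.subset hXE
  have hYf := M.ground_finite.subset hYE
  have hYX : ∀ y ∈ Y, y ∉ X := fun y hy hy' ↦ hd.notMem_of_mem_left hy' hy
  have hccl : c ∉ M.closure (Y \ {c}) := by
    intro hcl
    have h1 := M.rk_compl_lt_of_dual_dep hK.1.dep
    have hsub : Y \ {c} ⊆ M.E \ {b, c, d} := by
      rintro y ⟨hy, hyc⟩
      refine ⟨hYE hy, ?_⟩
      rintro (rfl | rfl | rfl)
      · exact hYX _ hy hb
      · exact hyc rfl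
      · exact hYX _ hy hdX
    have h2 := M.rk_insert_of_mem_closure (M.closure_subset_closure hsub hcl)
    have h3 : M.E \ {b, d} ⊆ insert c (M.E \ {b, c, d}) := by
      intro y hy
      simp only [mem_sdiff, mem_insert_iff, mem_singleton_iff] at hy ⊢
      tauto
    have h4 := M.rk_mono h3
    have h5 : ({b, d} : Set α).ncard ≤ 2 := by
      have := ncard_insert_le b {d}
      rwa [ncard_singleton] at this
    rw [hM.rk_sdiff_of_ncard_le_two hE (pair_subset (hXE hb) (hXE hdX)) h5] at h4
    omega
  have hYrk : M.rk Y = M.rk (Y \ {c}) + 1 := by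
    rw [← M.rk_insert_of_notMem_closure (hYE hc) hccl, insert_sdiff_singleton,
      insert_eq_of_mem hc]
  have hU' : insert c X ∪ Y \ {c} = M.E \ {a} := by
    rw [← hU]
    ext y
    simp only [mem_union, mem_insert_iff, mem_sdiff, mem_singleton_iff]
    by_cases hyc : y = c
    · simp [hyc, hc]
    · simp [hyc]
  have hd' : Disjoint (insert c X) (Y \ {c}) := by
    rw [disjoint_insert_left]
    exact ⟨by simp, hd.mono_right sdiff_subset⟩
  have hcard := ncard_sdiff_singleton_add_one hc hYf
  have hXins := M.rk_insert_le c X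
  have hsmall : (Y \ {c}).ncard = 1 := by
    by_contra hne
    refine hM.not_mem_and_mem_of_isTriangle hT hU' hd' ?_ (by omega) (by omega)
      ⟨mem_insert_of_mem _ hb, mem_insert _ _⟩
    have h1 : ({c, b} : Set α).ncard = 2 := ncard_pair hT.ne.2.2.symm
    have h2 := ncard_le_ncard (s := {c, b}) (t := insert c X)
      (insert_subset_insert (by simpa using hb)) (hXf.insert c)
    omega
  obtain ⟨y, hy⟩ := ncard_eq_one.1 hsmall
  have hyY : y ∈ Y \ {c} := hy ▸ rfl
  have hYeq : Y = {c, y} := by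
    rw [← insert_eq_of_mem hc, ← insert_sdiff_singleton, hy]
  have hya : y ≠ a := fun h ↦ (hYa hyY.1).2 h
  have hyc : y ≠ c := hyY.2
  refine ⟨y, hYE hyY.1, ?_, ?_⟩
  · rintro (rfl | rfl | rfl | rfl)
    · exact hya rfl
    · exact hYX _ hyY.1 hb
    · exact hyc rfl
    · exact hYX _ hyY.1 hdX
  · have hY2 := (M.indep_iff_rk_eq hYf).1 (hM.indep_of_ncard_le_two hE hYE (by omega))
    have h1 : M.E \ {a, c, y} = X := by
      rw [← hYeq]
      exact sdiff_insert_of_partition (by rw [union_comm, hU]) hd.symm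
    refine hM.isTriad_of_rk_lt hE ?_ (ncard_eq_three.2 ⟨a, c, y, hT.ne.2.1, hya.symm,
      hyc.symm, rfl⟩) (by rw [h1]; omega)
    rintro z (rfl | rfl | rfl)
    · exact haE
    · exact hYE hc
    · exact hYE hyY.1

/-- If a triangle `{a, b, c}` and a triad `{b, c, d}` form a fan and `M ＼ a` is not 3-connected,
then `a` is in a further triad with exactly one of `b` and `c`. -/
lemma IsKConnected.exists_isTriad_of_not_delete [M.Finite] (hM : M.IsKConnected 3)
    (hT : M.IsTriangle {a, b, c}) (hK : M.IsTriad {b, c, d}) (had : a ≠ d)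
    (hdel : ¬ (M ＼ {a}).IsKConnected 3) :
    ∃ y ∈ M.E, y ∉ ({a, b, c, d} : Set α) ∧ (M.IsTriad {a, b, y} ∨ M.IsTriad {a, c, y}) := by
  obtain ⟨hab, hac, hbc⟩ := hT.ne
  obtain ⟨-, hbd, hcd⟩ := hK.ne
  have haE : a ∈ M.E := hT.subset_ground (by simp)
  have hbE : b ∈ M.E := hT.subset_ground (by simp)
  have hcE : c ∈ M.E := hT.subset_ground (by simp)
  have hdE : d ∈ M.E := hK.subset_ground (by simp)
  have hE : 4 ≤ M.E.ncard := by
    have h4 : ({a, b, c, d} : Set α).ncard = 4 :=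
      ncard_eq_four.2 ⟨a, b, c, d, hab, hac, had, hbc, hbd, hcd, rfl⟩
    rw [← h4]
    refine ncard_le_ncard ?_ M.ground_finite
    rintro x (rfl | rfl | rfl | rfl) <;> assumption
  by_contra hcon
  apply hdel
  have hrE : (M ＼ {a}).rk (M ＼ {a}).E = M.rk M.E := by
    rw [delete_ground, delete_rk _ subset_rfl]
    exact hM.rk_sdiff_of_ncard_le_two hE (by simpa using haE) (by simp)
  refine isKConnected_three_of_forall (fun e he ↦ ?_) (fun X hX hX2 hY2 ↦ ?_)
  · rw [hrE, delete_ground, delete_rk _ sdiff_subset, delete_rk _ (by simpa using he)]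
    have h1 : M.rk {e} = 1 := by
      rw [(M.indep_iff_rk_eq (toFinite _)).1 (hM.indep_of_ncard_le_two hE
        (singleton_subset_iff.2 he.1) (by simp)), ncard_singleton]
    have h2 := hM.rk_sdiff_of_ncard_le_two hE (pair_subset haE he.1)
      (by have := ncard_insert_le a {e}; rwa [ncard_singleton] at this)
    rw [sdiff_sdiff, singleton_union, h1, h2]
    omega
  · rw [hrE]
    by_contra hlt
    rw [delete_ground] at hX hY2 hlt
    rw [delete_rk _ hX, delete_rk _ sdiff_subset] at hlt
    set Y := (M.E \ {a}) \ X with hYdef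
    have hU : X ∪ Y = M.E \ {a} := union_sdiff_cancel hX
    have hU' : Y ∪ X = M.E \ {a} := by rw [union_comm, hU]
    have hd : Disjoint X Y := disjoint_sdiff_right
    have hmem : ∀ e ∈ M.E, a ≠ e → e ∈ X ∨ e ∈ Y := fun e he hne ↦ by
      have : e ∈ X ∪ Y := hU ▸ ⟨he, fun h ↦ hne h.symm⟩
      exact this
    have h1 := hM.not_mem_and_mem_of_isTriangle hT hU hd hX2 hY2 (by omega)
    have h2 := hM.not_mem_and_mem_of_isTriangle hT hU' hd.symm hY2 hX2 (by omega)
    have key : ∀ y ∈ M.E, y ∉ ({a, b, c, d} : Set α) → M.IsTriad {a, b, y} → False :=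
      fun y h h' h'' ↦ hcon ⟨y, h, h', .inl h''⟩
    have key' : ∀ y ∈ M.E, y ∉ ({a, b, c, d} : Set α) → M.IsTriad {a, c, y} → False :=
      fun y h h' h'' ↦ hcon ⟨y, h, h', .inr h''⟩
    have hswap : ({a, c, b, d} : Set α) = {a, b, c, d} := by rw [insert_comm c b]
    -- The separation splits `b` from `c`; the one not on the side of `d` is the one to be moved.
    obtain hb | hb := hmem b hbE hab <;> obtain hc | hc := hmem c hcE hac
    · exact h1 ⟨hb, hc⟩
    · obtain hdm | hdm := hmem d hdE had
      · obtain ⟨y, hy, hy', hy''⟩ :=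
          hM.exists_isTriad_of_partition hE hT hK hU hd hY2 (by omega) hb hc hdm
        exact key' y hy hy' hy''
      · obtain ⟨y, hy, hy', hy''⟩ := hM.exists_isTriad_of_partition hE hT.swap_right hK.swap hU'
          hd.symm hX2 (by omega) hc hb hdm
        exact key y hy (hswap ▸ hy') hy''
    · obtain hdm | hdm := hmem d hdE had
      · obtain ⟨y, hy, hy', hy''⟩ := hM.exists_isTriad_of_partition hE hT.swap_right hK.swap hU
          hd hY2 (by omega) hc hb hdm
        exact key y hy (hswap ▸ hy') hy''
      · obtain ⟨y, hy, hy', hy''⟩ :=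
          hM.exists_isTriad_of_partition hE hT hK hU' hd.symm hX2 (by omega) hb hc hdm
        exact key' y hy hy' hy''
    · exact h2 ⟨hb, hc⟩

end Connectivity

/-! ### Alternating fans -/

/-- The first `k` terms of the sequence `x` are distinct, and the consecutive triples among them
are alternately triangles and triads, beginning with a triangle. -/
structure IsAltFan (M : Matroid α) (k : ℕ) (x : ℕ → α) : Prop where
  injOn : InjOn x (Iio k)
  isTriangle : ∀ i, i + 2 < k → Even i → M.IsTriangle {x i, x (i + 1), x (i + 2)}
  isTriad : ∀ i, i + 2 < k → Odd i → M.IsTriad {x i, x (i + 1), x (i + 2)}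

namespace IsAltFan

variable {M : Matroid α} {k : ℕ} {x : ℕ → α}

lemma ne (h : M.IsAltFan k x) {i j : ℕ} (hi : i < k) (hj : j < k) (hij : i ≠ j) : x i ≠ x j :=
  fun hx ↦ hij (h.injOn hi hj hx)

lemma mem_ground (h : M.IsAltFan k x) (hk : 3 ≤ k) {i : ℕ} (hi : i < k) : x i ∈ M.E := by
  obtain ⟨j, hj, hij⟩ : ∃ j, j + 2 < k ∧ (i = j ∨ i = j + 1 ∨ i = j + 2) := by
    by_cases h2 : i + 2 < k
    · exact ⟨i, h2, .inl rfl⟩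
    · by_cases h1 : i + 1 < k
      · exact ⟨i - 1, by omega, by omega⟩
      · exact ⟨i - 2, by omega, by omega⟩
  have hsub : {x j, x (j + 1), x (j + 2)} ⊆ M.E := by
    obtain hp | hp := Nat.even_or_odd j
    · exact (h.isTriangle j hj hp).subset_ground
    · exact (h.isTriad j hj hp).subset_ground
  obtain rfl | rfl | rfl := hij <;> exact hsub (by simp)

lemma image_subset_ground (h : M.IsAltFan k x) (hk : 3 ≤ k) : x '' Iio k ⊆ M.E := by
  rintro _ ⟨i, hi, rfl⟩
  exact h.mem_ground hk hi

lemma ncard_image (h : M.IsAltFan k x) : (x '' Iio k).ncard = k := by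
  rw [h.injOn.ncard_image]
  simp [ncard_eq_toFinset_card']

/-- Prepending an element shifts all parities, so the longer sequence alternates in the dual. -/
lemma cons (h : M.IsAltFan k x) {y : α} (hy : y ∉ x '' Iio k) (hT : M.IsTriad {y, x 0, x 1}) :
    M✶.IsAltFan (k + 1) (fun n ↦ Nat.casesOn n y x) where
  injOn := by
    rintro (_ | i) hi (_ | j) hj hij
    · rfl
    · exact (hy ⟨j, by simpa using hj, hij.symm⟩).elim
    · exact (hy ⟨i, by simpa using hi, hij⟩).elim
    · rw [h.injOn (by simpa using hi) (by simpa using hj) hij]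
  isTriangle := by
    rintro (_ | i) hi hp
    · exact hT
    · exact h.isTriad i (by omega) (by rw [← Nat.not_even_iff_odd]; grind)
  isTriad := by
    rintro (_ | i) hi hp
    · simp at hp
    · exact dual_isTriad.2 (h.isTriangle i (by omega) (by grind))

lemma image_cons (x : ℕ → α) (y : α) (k : ℕ) :
    (fun n ↦ (Nat.casesOn n y x : α)) '' Iio (k + 1) = insert y (x '' Iio k) := by
  ext z
  constructor
  · rintro ⟨_ | i, hi, rfl⟩
    · exact .inl rfl
    · exact .inr ⟨i, by simpa using hi, rfl⟩
  · rintro (rfl | ⟨i, hi, rfl⟩)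
    · exact ⟨0, by simp, rfl⟩
    · exact ⟨i + 1, by simpa using hi, rfl⟩

lemma injOn_reverse (h : M.IsAltFan k x) : InjOn (fun n ↦ x (k - 1 - n)) (Iio k) := by
  intro i hi j hj hij
  simp only [mem_Iio] at hi hj
  have := h.injOn (x₁ := k - 1 - i) (x₂ := k - 1 - j) (by simp; omega) (by simp; omega) hij
  omega

lemma reverse_odd (h : M.IsAltFan k x) (hk : Odd k) : M.IsAltFan k (fun n ↦ x (k - 1 - n)) where
  injOn := h.injOn_reverse
  isTriangle i hi hp := by
    have := h.isTriangle (k - 1 - (i + 2)) (by omega) (by grind)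
    rw [show k - 1 - (i + 2) + 1 = k - 1 - (i + 1) by omega,
      show k - 1 - (i + 2) + 2 = k - 1 - i by omega] at this
    exact this.swap_right.swap.swap_right
  isTriad i hi hp := by
    have := h.isTriad (k - 1 - (i + 2)) (by omega) (by grind)
    rw [show k - 1 - (i + 2) + 1 = k - 1 - (i + 1) by omega,
      show k - 1 - (i + 2) + 2 = k - 1 - i by omega] at this
    exact this.swap_right.swap.swap_right

lemma reverse_even (h : M.IsAltFan k x) (hk : Even k) :
    M✶.IsAltFan k (fun n ↦ x (k - 1 - n)) where
  injOn := h.injOn_reverse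
  isTriangle i hi hp := by
    have := h.isTriad (k - 1 - (i + 2)) (by omega) (by grind)
    rw [show k - 1 - (i + 2) + 1 = k - 1 - (i + 1) by omega,
      show k - 1 - (i + 2) + 2 = k - 1 - i by omega] at this
    exact this.swap_right.swap.swap_right
  isTriad i hi hp := by
    have := h.isTriangle (k - 1 - (i + 2)) (by omega) (by grind)
    rw [show k - 1 - (i + 2) + 1 = k - 1 - (i + 1) by omega,
      show k - 1 - (i + 2) + 2 = k - 1 - i by omega] at this
    exact dual_isTriad.2 this.swap_right.swap.swap_right

lemma image_reverse (x : ℕ → α) (k : ℕ) : (fun n ↦ x (k - 1 - n)) '' Iio k = x '' Iio k := by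
  ext z
  constructor
  · rintro ⟨i, hi, rfl⟩
    exact ⟨k - 1 - i, by simp at hi ⊢; omega, rfl⟩
  · rintro ⟨i, hi, rfl⟩
    simp only [mem_Iio] at hi
    exact ⟨k - 1 - i, by simp; omega, by simp only; congr 1; omega⟩

/-- The elements at even positions span the fan, except possibly its last element. -/
lemma mem_closure_even (h : M.IsAltFan k x) (hk : 3 ≤ k) {n : ℕ} (hn : n + 1 < k) :
    x n ∈ M.closure (x '' {i | i < k ∧ Even i}) := by
  have hsub : x '' {i | i < k ∧ Even i} ⊆ M.E := by
    rintro _ ⟨i, hi, rfl⟩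
    exact h.mem_ground hk hi.1
  obtain hp | hp := Nat.even_or_odd n
  · exact M.subset_closure _ hsub ⟨n, ⟨by omega, hp⟩, rfl⟩
  · obtain ⟨m, rfl⟩ := hp
    have := (h.isTriangle (2 * m) hn (by simp)).swap.mem_closure
    refine M.closure_subset_closure ?_ this
    rintro _ (rfl | rfl)
    · exact ⟨_, ⟨by omega, by simp⟩, rfl⟩
    · exact ⟨_, ⟨by omega, by grind⟩, rfl⟩

lemma mem_closure_dual_odd (h : M.IsAltFan k x) (hk : 3 ≤ k) (hkp : Even k)
    (hlast : M.IsTriad {x (k - 1), x 0, x 1}) {n : ℕ} (hn : n < k) :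
    x n ∈ M✶.closure (x '' {i | i < k ∧ Odd i}) := by
  have hsub : x '' {i | i < k ∧ Odd i} ⊆ M✶.E := by
    rintro _ ⟨i, hi, rfl⟩
    exact h.mem_ground hk hi.1
  obtain hp | hp := Nat.even_or_odd n
  · rcases n with _ | n
    · refine M✶.closure_subset_closure ?_ (IsTriangle.mem_closure hlast.swap)
      rintro _ (rfl | rfl)
      · exact ⟨_, ⟨by omega, by grind⟩, rfl⟩
      · exact ⟨_, ⟨by omega, by simp⟩, rfl⟩
    · refine M✶.closure_subset_closure ?_
        (IsTriangle.mem_closure (h.isTriad n (by grind) (by grind)).swap)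
      rintro _ (rfl | rfl)
      · exact ⟨_, ⟨by omega, by grind⟩, rfl⟩
      · exact ⟨_, ⟨by grind, by grind⟩, rfl⟩
  · exact M✶.subset_closure _ hsub ⟨n, ⟨hn, hp⟩, rfl⟩

lemma ncard_even_le (x : ℕ → α) (m : ℕ) : (x '' {i | i < 2 * m ∧ Even i}).ncard ≤ m := by
  have : x '' {i | i < 2 * m ∧ Even i} ⊆ (fun i ↦ x (2 * i)) '' Iio m := by
    rintro _ ⟨i, ⟨hi, j, rfl⟩, rfl⟩
    exact ⟨j, by simp; omega, by simp [two_mul]⟩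
  refine (ncard_le_ncard this (toFinite _)).trans ((ncard_image_le (toFinite _)).trans ?_)
  simp [ncard_eq_toFinset_card']

lemma ncard_odd_le (x : ℕ → α) (m : ℕ) : (x '' {i | i < 2 * m ∧ Odd i}).ncard ≤ m := by
  have : x '' {i | i < 2 * m ∧ Odd i} ⊆ (fun i ↦ x (2 * i + 1)) '' Iio m := by
    rintro _ ⟨i, ⟨hi, j, rfl⟩, rfl⟩
    exact ⟨j, by simp; omega, rfl⟩
  refine (ncard_le_ncard this (toFinite _)).trans ((ncard_image_le (toFinite _)).trans ?_)
  simp [ncard_eq_toFinset_card']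

lemma finite_image_sep (x : ℕ → α) (k : ℕ) (p : ℕ → Prop) : (x '' {i | i < k ∧ p i}).Finite :=
  ((finite_Iio k).subset fun _ hi ↦ hi.1).image x

/-- The ground set of a 3-connected matroid with a fan closed up by a triad is the fan. -/
lemma ground_eq_of_isTriad_last [M.Finite] (hM : M.IsKConnected 3) (h : M.IsAltFan k x)
    (hk : 4 ≤ k) (hkp : Even k) (hlast : M.IsTriad {x (k - 1), x 0, x 1}) :
    M.E = x '' Iio k := by
  have hFE := h.image_subset_ground (by omega)
  have hFk := h.ncard_image
  have hE : 4 ≤ M.E.ncard := hk.trans (hFk ▸ ncard_le_ncard hFE M.ground_finite)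
  obtain ⟨m, hm⟩ := hkp.exists_two_nsmul
  simp only [smul_eq_mul] at hm
  -- With `r(F) ≤ m + 1`, `r*(F) ≤ m` and `|F| = 2m`, the connectivity `r(F) + r*(F) - |F|` is at
  -- most one, so at most one element lies outside the fan.
  have hrF : M.rk (x '' Iio k) ≤ m + 1 := by
    have hsub : x '' Iio k ⊆ M.closure (insert (x (k - 1)) (x '' {i | i < k ∧ Even i})) := by
      rintro _ ⟨n, hn, rfl⟩
      simp only [mem_Iio] at hn
      by_cases hn' : n + 1 < k
      · exact M.closure_subset_closure (subset_insert _ _) (h.mem_closure_even (by omega) hn')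
      · rw [show n = k - 1 by omega]
        exact M.mem_closure_of_mem' (mem_insert _ _) (h.mem_ground (by omega) (by omega))
    have h1 := M.rk_le_of_subset_closure hsub
    have h2 := M.rk_insert_le (x (k - 1)) (x '' {i | i < k ∧ Even i})
    have h3 := M.rk_le_ncard (finite_image_sep x k Even)
    have h4 := ncard_even_le x m
    rw [← hm] at h4
    omega
  have hclF : x '' Iio k ⊆ M✶.closure (x '' {i | i < k ∧ Odd i}) := by
    rintro _ ⟨n, hn, rfl⟩
    exact h.mem_closure_dual_odd (by omega) hkp hlast hn
  have hrF' : M✶.rk (x '' Iio k) ≤ m := by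
    have h1 := M✶.rk_le_of_subset_closure hclF
    have h3 := M✶.rk_le_ncard (finite_image_sep x k Odd)
    have h4 := ncard_odd_le x m
    rw [← hm] at h4
    omega
  have hdual := M.rk_dual hFE
  have hsmall : (M.E \ x '' Iio k).ncard ≤ 1 := by
    by_contra hcon
    have := hM.le_rk_add hFE (by omega) (by omega)
    omega
  refine subset_antisymm ?_ hFE
  rw [← sdiff_eq_empty]
  by_contra hne
  obtain ⟨z, hz⟩ := nonempty_iff_ne_empty.2 hne
  have hzF : M.E \ {z} ⊆ x '' Iio k := by
    rintro y ⟨hy, hyz⟩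
    by_contra hyF
    exact hyz ((ncard_le_one (M.ground_finite.subset sdiff_subset)).1 hsmall y ⟨hy, hyF⟩ z hz)
  -- An outside element `z` would be in a cocircuit whose other elements have odd positions.
  -- Orthogonality with the triangles rules out every such position except `k - 1`, leaving a
  -- cocircuit of size at most two.
  have hzcl : z ∈ M✶.closure (x '' {i | i < k ∧ Odd i}) :=
    M✶.closure_subset_closure_of_subset_closure (hzF.trans hclF)
      (hM.dual.mem_closure_sdiff hE hz.1)
  obtain ⟨C, hCsub, hC, hzC⟩ := exists_isCircuit_of_mem_closure hzcl
    (fun ⟨i, hi, hiz⟩ ↦ hz.2 ⟨i, hi.1, hiz⟩)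
  have hCx : ∀ i < k, x i ∈ C → Odd i := by
    intro i hi hiC
    obtain h' | ⟨j, hj, hji⟩ := hCsub hiC
    · exact (hz.2 ⟨i, hi, h'⟩).elim
    · rw [← h.injOn hj.1 hi hji]
      exact hj.2
  have hCle : C ⊆ {z, x (k - 1)} := by
    intro y hy
    obtain rfl | ⟨i, ⟨hik, j, rfl⟩, rfl⟩ := hCsub hy
    · simp
    · by_cases hlt : 2 * j + 2 < k
      · obtain h' | h' := (h.isTriangle (2 * j) hlt (by simp)).swap.mem_or_mem hC hy
        · have := hCx _ (by omega) h'
          grind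
        · have := hCx _ (by omega) h'
          grind
      · rw [show k - 1 = 2 * j + 1 by omega]
        simp
  have h3 := hM.dual.three_le_ncard_of_isCircuit hE hC
  have h4 := ncard_le_ncard hCle (toFinite _)
  have h5 := ncard_insert_le z {x (k - 1)}
  rw [ncard_singleton] at h5
  omega

/-- The last element lies in a circuit with elements at even positions. The triads centred at even
positions rule out all of these except `0` and `k - 2`, and a circuit has at least three elements.
-/
lemma isTriangle_last [M.Finite] (hM : M.IsKConnected 3) (h : M.IsAltFan k x)
    (hk : 4 ≤ k) (hkp : Even k) (hE : M.E = x '' Iio k) :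
    M.IsTriangle {x (k - 2), x (k - 1), x 0} := by
  have hE4 : 4 ≤ M.E.ncard := by rw [hE, h.ncard_image]; exact hk
  have hcl : x (k - 1) ∈ M.closure (x '' {i | i < k ∧ Even i}) := by
    refine M.closure_subset_closure_of_subset_closure ?_
      (hM.mem_closure_sdiff hE4 (h.mem_ground (i := k - 1) (by omega) (by omega)))
    rw [hE]
    rintro _ ⟨⟨n, hn, rfl⟩, hne⟩
    simp only [mem_Iio] at hn
    refine h.mem_closure_even (by omega) ?_
    by_contra hcon
    exact hne (by rw [show n = k - 1 by omega]; rfl)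
  have hnot : x (k - 1) ∉ x '' {i | i < k ∧ Even i} := by
    rintro ⟨i, hi, hi'⟩
    have h1 := h.injOn hi.1 (show k - 1 < k by omega) hi'
    have h2 := hi.2
    grind
  obtain ⟨C, hCsub, hC, hzC⟩ := exists_isCircuit_of_mem_closure hcl hnot
  have hCx : ∀ i < k, x i ∈ C → i = k - 1 ∨ Even i := by
    intro i hi hiC
    obtain h' | ⟨j, hj, hji⟩ := hCsub hiC
    · exact .inl (h.injOn hi (show k - 1 < k by omega) h')
    · rw [← h.injOn hj.1 hi hji]
      exact .inr hj.2
  have hCle : C ⊆ {x (k - 2), x (k - 1), x 0} := by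
    intro y hy
    obtain rfl | ⟨i, ⟨hik, hi⟩, rfl⟩ := hCsub hy
    · simp
    · rcases i with _ | i
      · simp
      · by_cases hlt : i + 3 < k
        · obtain h' | h' := IsTriangle.mem_or_mem (h.isTriad i (by omega) (by grind)).swap
            (by rwa [dual_dual]) hy
          · have := hCx _ (by omega) h'
            grind
          · have := hCx _ (by omega) h'
            grind
        · rw [show k - 2 = i + 1 by grind]
          simp
  have h3 := hM.three_le_ncard_of_isCircuit hE4 hC
  have hcard : ({x (k - 2), x (k - 1), x 0} : Set α).ncard = 3 :=
    ncard_eq_three.2 ⟨_, _, _, h.ne (by omega) (by omega) (by omega),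
      h.ne (by omega) (by omega) (by omega), h.ne (by omega) (by omega) (by omega), rfl⟩
  have hCeq := eq_of_subset_of_ncard_le hCle (by omega) (toFinite _)
  rw [← hCeq]
  exact ⟨hC, by rw [hCeq, ← (toFinite _).cast_ncard_eq, hcard]; rfl⟩

lemma isCyclicFan [M.Finite] (hM : M.IsKConnected 3) (h : M.IsAltFan k x)
    (hk : 4 ≤ k) (hkp : Even k) (hlast : M.IsTriad {x (k - 1), x 0, x 1}) :
    ∃ r φ, M.IsCyclicFan r φ := by
  have hE := h.ground_eq_of_isTriad_last hM hk hkp hlast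
  have htri := h.isTriangle_last hM hk hkp hE
  obtain ⟨m, hm⟩ := hkp.exists_two_nsmul
  simp only [smul_eq_mul] at hm
  have : Fact (1 < m) := ⟨by omega⟩
  have : NeZero m := ⟨by omega⟩
  have hval : ∀ i : ZMod m, i.val < m := fun i ↦ i.val_lt
  have hsucc : ∀ i : ZMod m, (i.val + 1 < m ∧ (i + 1).val = i.val + 1) ∨
      (i.val + 1 = m ∧ (i + 1).val = 0) := by
    intro i
    have h1 : (i + 1).val = (i.val + 1) % m := by rw [ZMod.val_add, ZMod.val_one]
    have h2 := hval i
    by_cases h3 : i.val + 1 < m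
    · exact .inl ⟨h3, by rw [h1, Nat.mod_eq_of_lt h3]⟩
    · have h4 : i.val + 1 = m := by omega
      exact .inr ⟨h4, by rw [h1, h4, Nat.mod_self]⟩
  refine ⟨m, Sum.elim (fun i ↦ x (2 * i.val)) (fun i ↦ x (2 * i.val + 1)), by omega, ?_, ?_,
    ?_, ?_⟩
  · rintro (i | i) (j | j) hij
    all_goals
      have h1 := hval i
      have h2 := hval j
      have h3 := h.injOn (by simp; omega) (by simp; omega) hij
    · rw [ZMod.val_injective m (show i.val = j.val by omega)]
    · omega
    · omega
    · rw [ZMod.val_injective m (show i.val = j.val by omega)]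
  · rw [hE]
    ext y
    constructor
    · rintro ⟨i | i, rfl⟩
      all_goals have h1 := hval i
      · exact ⟨2 * i.val, by simp; omega, rfl⟩
      · exact ⟨2 * i.val + 1, by simp; omega, rfl⟩
    · rintro ⟨n, hn, rfl⟩
      simp only [mem_Iio] at hn
      obtain ⟨j, hj | hj⟩ := Nat.even_or_odd' n
      · exact ⟨.inl (j : ZMod m), by simp [ZMod.val_natCast_of_lt (show j < m by omega), hj]⟩
      · exact ⟨.inr (j : ZMod m), by simp [ZMod.val_natCast_of_lt (show j < m by omega), hj]⟩
  · intro i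
    simp only [Sum.elim_inl, Sum.elim_inr]
    obtain ⟨h1, h2⟩ | ⟨h1, h2⟩ := hsucc i
    · rw [h2]
      exact h.isTriangle (2 * i.val) (by omega) (by simp)
    · rw [h2]
      rwa [show k - 2 = 2 * i.val by omega, show k - 1 = 2 * i.val + 1 by omega] at htri
  · intro i
    simp only [Sum.elim_inl, Sum.elim_inr]
    obtain ⟨h1, h2⟩ | ⟨h1, h2⟩ := hsucc i
    · rw [h2]
      exact h.isTriad (2 * i.val + 1) (by omega) (by simp)
    · rw [h2]
      rwa [show k - 1 = 2 * i.val + 1 by omega] at hlast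

end IsAltFan

/-! ### Removing an end of a maximal alternating fan -/

section Ends

variable {M N : Matroid α} {k : ℕ} {x : ℕ → α}

/-- No alternating fan of `M` or of its dual properly contains the set `F`. -/
def IsAltMaximal (M : Matroid α) (F : Set α) : Prop :=
  ∀ (m : ℕ) (y : ℕ → α), M.IsAltFan m y ∨ M✶.IsAltFan m y → ¬ F ⊂ y '' Iio m

lemma IsAltMaximal.dual {F : Set α} (h : M.IsAltMaximal F) : M✶.IsAltMaximal F := by
  intro m y hy
  rw [dual_dual] at hy
  exact h m y hy.symm

lemma IsAltMaximal.mem_of_isTriad {F : Set α} (hmax : M.IsAltMaximal F) (h : M.IsAltFan k x)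
    (hF : x '' Iio k = F) {y : α} (hT : M.IsTriad {y, x 0, x 1}) : y ∈ F := by
  by_contra hy
  rw [← hF] at hy
  refine hmax _ _ (.inr (h.cons hy hT)) ?_
  rw [IsAltFan.image_cons, ← hF]
  exact ssubset_insert hy

/-- In a fan of length four the middle elements are interchangeable, so a triad through `x 0` and `x
2` is as useful as one through `x 0` and `x 1`. -/
lemma IsAltFan.swap_middle (h : M.IsAltFan 4 x) :
    M.IsAltFan 4 (fun n ↦ x (Equiv.swap 1 2 n)) ∧
      (fun n ↦ x (Equiv.swap 1 2 n)) '' Iio 4 = x '' Iio 4 := by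
  have hlt : ∀ n < 4, Equiv.swap 1 2 n < 4 := by decide
  have h1 := (h.isTriangle 0 (by omega) (by simp)).swap_right
  have h2 := (h.isTriad 1 (by omega) (by simp)).swap
  refine ⟨⟨?_, ?_, ?_⟩, ?_⟩
  · intro i hi j hj hij
    exact (Equiv.swap 1 2).injective (h.injOn (hlt i hi) (hlt j hj) hij)
  · intro i hi hp
    obtain rfl : i = 0 := by grind
    exact h1
  · intro i hi hp
    obtain rfl : i = 1 := by grind
    exact h2
  · ext z
    constructor
    · rintro ⟨i, hi, rfl⟩
      exact ⟨_, hlt i hi, rfl⟩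
    · rintro ⟨i, hi, rfl⟩
      exact ⟨_, hlt i hi, by simp⟩

/-- If a fan of length at least five is closed up by a triad through its first, third and fifth
elements, then its first two elements are in another triad. -/
lemma IsAltFan.exists_isTriad_of_first_third_fifth [M.Finite] (hM : M.IsKConnected 3)
    (h : M.IsAltFan k x) (hk : 5 ≤ k) (hT : M.IsTriad {x 0, x 2, x 4}) :
    ∃ z, z ∉ x '' Iio 4 ∧ M.IsTriad {z, x 0, x 1} := by
  have hfan : M.IsAltFan 5 x := ⟨h.injOn.mono (Iio_subset_Iio hk),
    fun i hi hp ↦ h.isTriangle i (by omega) hp, fun i hi hp ↦ h.isTriad i (by omega) hp⟩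
  set A := x '' Iio 5 with hA
  have hAE : A ⊆ M.E := hfan.image_subset_ground (by omega)
  have hA5 : A.ncard = 5 := hfan.ncard_image
  have hE : 5 ≤ M.E.ncard := hA5 ▸ ncard_le_ncard hAE M.ground_finite
  have hmem : ∀ i < 5, x i ∈ M.E := fun i hi ↦ hAE ⟨i, hi, rfl⟩
  have ht0 := h.isTriangle 0 (by omega) (by simp)
  have ht2 := h.isTriangle 2 (by omega) (by decide)
  have hK1 := h.isTriad 1 (by omega) (by simp)
  simp only [zero_add, Nat.reduceAdd] at ht0 ht2 hK1
  have hthree : ∀ a b c : α, ({a, b, c} : Set α).ncard ≤ 3 := fun a b c ↦ by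
    have h1 := ncard_insert_le a {b, c}
    have h2 := ncard_insert_le b {c}
    rw [ncard_singleton] at h2
    omega
  have hclA : A ⊆ M.closure {x 0, x 2, x 4} := by
    rintro _ ⟨i, hi, rfl⟩
    have hsub : {x 0, x 2, x 4} ⊆ M.E := hT.subset_ground
    simp only [mem_Iio] at hi
    interval_cases i
    · exact M.subset_closure _ hsub (by simp)
    · exact M.closure_subset_closure (by rintro y (rfl | rfl) <;> simp) ht0.swap.mem_closure
    · exact M.subset_closure _ hsub (by simp)
    · exact M.closure_subset_closure (by rintro y (rfl | rfl) <;> simp) ht2.swap.mem_closure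
    · exact M.subset_closure _ hsub (by simp)
  have hclA' : A ⊆ M✶.closure {x 0, x 1, x 2} := by
    rintro _ ⟨i, hi, rfl⟩
    have hsub : {x 0, x 1, x 2} ⊆ M✶.E := ht0.subset_ground
    simp only [mem_Iio] at hi
    interval_cases i
    · exact M✶.subset_closure _ hsub (by simp)
    · exact M✶.subset_closure _ hsub (by simp)
    · exact M✶.subset_closure _ hsub (by simp)
    · exact M✶.closure_subset_closure (by rintro y (rfl | rfl) <;> simp)
        (IsTriangle.mem_closure hK1.swap_right.swap)
    · exact M✶.closure_subset_closure (by rintro y (rfl | rfl) <;> simp)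
        (IsTriangle.mem_closure hT.swap_right.swap)
  have hr : M.rk A ≤ 3 := (M.rk_le_of_subset_closure hclA).trans
    ((M.rk_le_ncard (toFinite _)).trans (hthree _ _ _))
  have hr' : M✶.rk A ≤ 3 := (M✶.rk_le_of_subset_closure hclA').trans
    ((M✶.rk_le_ncard (toFinite _)).trans (hthree _ _ _))
  have hdual := M.rk_dual hAE
  -- `r(A) + r*(A) - |A| ≤ 3 + 3 - 5 = 1`.
  have hsmall : (M.E \ A).ncard ≤ 1 := by
    by_contra hcon
    have := hM.le_rk_add hAE (by omega) (by omega)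
    omega
  have hspan : ∀ {M' : Matroid α} [M'.Finite], M'.IsKConnected 3 → M'.E = M.E →
      M'.rk M'.E ≤ M'.rk A := by
    intro M' _ hM' hE'
    refine M'.rk_le_of_subset_closure fun e he ↦ ?_
    by_cases heA : e ∈ A
    · exact M'.mem_closure_of_mem' heA he
    · refine M'.closure_subset_closure ?_ (hM'.mem_closure_sdiff (by rw [hE']; omega) he)
      rintro y ⟨hy, hye⟩
      by_contra hyA
      rw [hE'] at hy he
      exact hye ((ncard_le_one (M.ground_finite.subset sdiff_subset)).1 hsmall y ⟨hy, hyA⟩ e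
        ⟨he, heA⟩)
  have hrE := hspan hM rfl
  have hrE' := hspan hM.dual rfl
  have hsum := M.rk_dual (X := M.E) subset_rfl
  rw [dual_ground] at hrE'
  have hzero : M.rk (M.E \ M.E) = 0 := by simp [rk]
  have hcard := ncard_sdiff_add_ncard_of_subset hAE M.ground_finite
  -- On five elements, the triangle would force `r(M) ≤ 2` and the triad `r*(M) ≤ 2`, but these
  -- ranks add up to five. So there are six elements and both ranks are three.
  have hne : (M.E \ A).Nonempty := by
    rw [nonempty_iff_ne_empty]
    intro hempty
    rw [hempty, ncard_empty] at hcard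
    have hc : ∀ {T : Set α}, T ⊆ M.E → T.ncard = 3 → (M.E \ T).ncard = 2 := fun hT hT3 ↦ by
      have := ncard_sdiff_add_ncard_of_subset hT M.ground_finite
      omega
    have h1 := hM.le_rk_add ht0.subset_ground (by rw [ht0.ncard_eq]; omega)
      (hc ht0.subset_ground ht0.ncard_eq).ge
    have h2 := hM.dual.le_rk_add hK1.subset_ground (by rw [IsTriangle.ncard_eq hK1]; omega)
      (hc hK1.subset_ground (IsTriangle.ncard_eq hK1)).ge
    rw [dual_ground] at h2
    have h3 := M.rk_le_ncard (X := M.E \ {x 0, x 1, x 2}) (M.ground_finite.subset sdiff_subset)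
    have h4 := M✶.rk_le_ncard (X := M.E \ {x 1, x 2, x 3}) (M.ground_finite.subset sdiff_subset)
    rw [hc ht0.subset_ground ht0.ncard_eq] at h3
    rw [hc hK1.subset_ground (IsTriangle.ncard_eq hK1)] at h4
    have h5 := ht0.rk_le
    have h6 := IsTriangle.rk_le hK1
    omega
  obtain ⟨z, hz⟩ := hne
  have hzA : ∀ i < 5, z ≠ x i := fun i hi hzi ↦ hz.2 ⟨i, hi, hzi.symm⟩
  have hcompl : M.E \ {z, x 0, x 1} ⊆ {x 2, x 3, x 4} := by
    rintro y ⟨hy, hy'⟩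
    simp only [mem_insert_iff, mem_singleton_iff, not_or] at hy'
    by_cases hyA : y ∈ A
    · obtain ⟨i, hi, rfl⟩ := hyA
      simp only [mem_Iio] at hi
      interval_cases i <;> simp_all
    · exact (hy'.1 ((ncard_le_one (M.ground_finite.subset sdiff_subset)).1 hsmall y ⟨hy, hyA⟩ z
        hz)).elim
  refine ⟨z, fun hz4 ↦ hz.2 (image_mono (Iio_subset_Iio (by omega)) hz4), ?_⟩
  refine hM.isTriad_of_rk_lt (by omega) ?_ (ncard_eq_three.2 ⟨z, x 0, x 1, hzA 0 (by omega),
    hzA 1 (by omega), ht0.ne.1, rfl⟩) ?_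
  · rintro y (rfl | rfl | rfl)
    · exact hz.1
    · exact hmem 0 (by omega)
    · exact hmem 1 (by omega)
  · have h1 := M.rk_mono hcompl
    have h2 := ht2.rk_le
    have h3 : 0 < (M.E \ A).ncard :=
      (ncard_pos (M.ground_finite.subset sdiff_subset)).2 ⟨z, hz⟩
    omega

/-- Deleting the first element of a maximal fan that begins with a triangle preserves
3-connectedness, unless the fan closes up to the whole matroid. -/
theorem IsAltFan.delete_first_isKConnected [M.Finite] (hM : M.IsKConnected 3)
    (h : M.IsAltFan k x) (hk : 4 ≤ k) (hmax : M.IsAltMaximal (x '' Iio k))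
    (hcyc : ¬ ∃ r φ, M.IsCyclicFan r φ) : (M ＼ {x 0}).IsKConnected 3 := by
  by_contra hdel
  have ht0 := h.isTriangle 0 (by omega) (by simp)
  have hK1 := h.isTriad 1 (by omega) (by simp)
  simp only [zero_add, Nat.reduceAdd] at ht0 hK1
  have hset : ({x 0, x 1, x 2, x 3} : Set α) = x '' Iio 4 := by
    ext y
    constructor
    · rintro (rfl | rfl | rfl | rfl)
      exacts [⟨0, by simp, rfl⟩, ⟨1, by simp, rfl⟩, ⟨2, by simp, rfl⟩, ⟨3, by simp, rfl⟩]
    · rintro ⟨i, hi, rfl⟩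
      simp only [mem_Iio] at hi
      interval_cases i <;> simp
  obtain ⟨z, hz4, hzT⟩ : ∃ z, z ∉ x '' Iio 4 ∧ M.IsTriad {z, x 0, x 1} := by
    obtain ⟨y, -, hy4, hy⟩ := hM.exists_isTriad_of_not_delete ht0 hK1
      (h.ne (by omega) (by omega) (by omega)) hdel
    obtain hy | hy := hy
    · exact ⟨y, hset ▸ hy4, hy.swap_right.swap⟩
    obtain rfl | hk5 : k = 4 ∨ 5 ≤ k := by omega
    · have := hmax.mem_of_isTriad h.swap_middle.1 h.swap_middle.2 (y := y) hy.swap_right.swap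
      exact (hy4 (hset ▸ this)).elim
    -- Orthogonality of the triad `{x 0, x 2, y}` with the triangle `{x 2, x 3, x 4}` leaves only `y
    -- = x 4`.
    · have ht2 := h.isTriangle 2 (by omega) (by decide)
      obtain h' | h' := ht2.mem_or_mem hy.1 (by simp)
      · rcases h' with h' | h' | h'
        · exact (h.ne (by omega) (by omega) (by omega) h').elim
        · exact (h.ne (by omega) (by omega) (by omega) h').elim
        · exact (hy4 (by rw [← mem_singleton_iff.1 h']; simp)).elim
      · rcases h' with h' | h' | h'
        · exact (h.ne (by omega) (by omega) (by omega) h').elim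
        · exact (h.ne (by omega) (by omega) (by omega) h').elim
        · rw [← mem_singleton_iff.1 h'] at hy
          exact h.exists_isTriad_of_first_third_fifth hM hk5 hy
  obtain ⟨j, hj, rfl⟩ := hmax.mem_of_isTriad h rfl hzT
  simp only [mem_Iio] at hj
  have hj4 : 4 ≤ j := by
    by_contra hcon
    exact hz4 ⟨j, by simp; omega, rfl⟩
  have hnot : ∀ i < k, i ≠ j → 2 ≤ i → x i ∉ ({x j, x 0, x 1} : Set α) := by
    intro i hi hij hi2 hmem
    rcases hmem with h' | h' | h' <;> exact h.ne hi (by omega) (by omega) h'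
  -- Otherwise some triangle of the fan contains `x j` and two further elements at positions at
  -- least two, so it meets the triad in `x j` alone.
  have hjk : Odd j ∧ k = j + 1 := by
    obtain hp | hp := Nat.even_or_odd j
    · have := h.isTriangle (j - 2) (by omega) (by grind)
      rw [show j - 2 + 2 = j by omega] at this
      obtain h' | h' := this.swap_right.swap.mem_or_mem hzT.1 (by simp)
      · exact (hnot _ (by omega) (by omega) (by omega) h').elim
      · exact (hnot _ (by omega) (by omega) (by omega) h').elim
    · refine ⟨hp, ?_⟩
      by_contra hne
      have := h.isTriangle (j - 1) (by omega) (by grind)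
      rw [show j - 1 + 1 = j by omega] at this
      obtain h' | h' := this.swap.mem_or_mem hzT.1 (by simp)
      · exact hnot _ (by omega) (by omega) (by omega) h'
      · exact hnot _ (by omega) (by omega) (by omega) h'
  obtain ⟨hodd, rfl⟩ := hjk
  exact hcyc (h.isCyclicFan hM hk hodd.add_one (by simpa using hzT))

/-! ### Keeping a minor -/

lemma IsAltFan.isMinor_delete_first (h : M.IsAltFan k x) (hk : 4 ≤ k) (hN : N ≤m M)
    (hl : ∀ e, ¬ N.IsLoop e) (hcl : ∀ e, ¬ N.IsColoop e)
    (hone : ∀ i < k, ∀ j < k, x i ∈ N.E → x j ∈ N.E → i = j) (h0 : x 0 ∉ N.E) :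
    N ≤m M ＼ {x 0} ∨ (x 1 ∈ N.E ∨ x 2 ∈ N.E) ∧ N ≤m M ／ {x 3} := by
  have ht0 := h.isTriangle 0 (by omega) (by simp)
  have hK1 := h.isTriad 1 (by omega) (by simp)
  simp only [zero_add, Nat.reduceAdd] at ht0 hK1
  have h03 : x 0 ≠ x 3 := h.ne (by omega) (by omega) (by omega)
  by_cases h1 : x 1 ∈ N.E
  · have h2 : x 2 ∉ N.E := fun h2 ↦ by have := hone 1 (by omega) 2 (by omega) h1 h2; omega
    have h3 : x 3 ∉ N.E := fun h3 ↦ by have := hone 1 (by omega) 3 (by omega) h1 h3; omega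
    exact (isMinor_contract_of_triangle_triad ht0.swap_right hK1.swap h03 hN hl hcl h0 h2 h3).imp
      id fun h' ↦ ⟨.inl h1, h'⟩
  · by_cases h2 : x 2 ∈ N.E
    · have h3 : x 3 ∉ N.E := fun h3 ↦ by have := hone 2 (by omega) 3 (by omega) h2 h3; omega
      exact (isMinor_contract_of_triangle_triad ht0 hK1 h03 hN hl hcl h0 h1 h3).imp
        id fun h' ↦ ⟨.inr h2, h'⟩
    · exact .inl (isMinor_delete_of_triangle_triad ht0 hK1 h03 hN hl hcl h0 h1 h2)

theorem IsAltFan.exists_end_isKConnected_isMinor [M.Finite] (hM : M.IsKConnected 3)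
    (h : M.IsAltFan k x) (hk : 4 ≤ k) (hmax : M.IsAltMaximal (x '' Iio k))
    (hcyc : ¬ ∃ r φ, M.IsCyclicFan r φ) (hN : N ≤m M)
    (hl : ∀ e, ¬ N.IsLoop e) (hcl : ∀ e, ¬ N.IsColoop e)
    (hone : ∀ i < k, ∀ j < k, x i ∈ N.E → x j ∈ N.E → i = j) :
    ((M ＼ {x 0}).IsKConnected 3 ∧ N ≤m M ＼ {x 0}) ∨
      ((M ＼ {x (k - 1)}).IsKConnected 3 ∧ N ≤m M ＼ {x (k - 1)}) ∨
      ((M ／ {x (k - 1)}).IsKConnected 3 ∧ N ≤m M ／ {x (k - 1)}) := by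
  by_cases hfirst : N ≤m M ＼ {x 0}
  · exact .inl ⟨h.delete_first_isKConnected hM hk hmax hcyc, hfirst⟩
  right
  have hfail : x 0 ∈ N.E ∨ (x 1 ∈ N.E ∨ x 2 ∈ N.E) ∧ N ≤m M ／ {x 3} := by
    by_cases h0 : x 0 ∈ N.E
    · exact .inl h0
    · exact .inr ((h.isMinor_delete_first hk hN hl hcl hone h0).resolve_left hfirst)
  obtain ⟨j, hj, hjN, hj3⟩ : ∃ j < 3, x j ∈ N.E ∧ (j = 0 ∨ N ≤m M ／ {x 3}) := by
    obtain h0 | ⟨h1 | h1, h3⟩ := hfail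
    exacts [⟨0, by omega, h0, .inl rfl⟩, ⟨1, by omega, h1, .inr h3⟩, ⟨2, by omega, h1, .inr h3⟩]
  have honly : ∀ i < k, x i ∈ N.E → i = j := fun i hi hiN ↦ hone i hi j (by omega) hiN hjN
  have hlastN : x (k - 1 - 0) ∉ N.E := fun hN ↦ by have := honly _ (by omega) hN; omega
  have hone' : ∀ i < k, ∀ j < k, x (k - 1 - i) ∈ N.E → x (k - 1 - j) ∈ N.E → i = j := by
    intro i hi j hj h1 h2
    have := hone _ (by omega) _ (by omega) h1 h2
    omega
  obtain hp | hp := Nat.even_or_odd k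
  · right
    have hrev := h.reverse_even hp
    refine ⟨isKConnected_of_dual ?_, ?_⟩
    · rw [dual_contract]
      exact hrev.delete_first_isKConnected hM.dual hk
        (by rw [IsAltFan.image_reverse]; exact hmax.dual) (fun ⟨r, φ, hφ⟩ ↦
          hcyc ⟨r, _, by simpa using hφ.dual⟩)
    · obtain h' | ⟨h', -⟩ := hrev.isMinor_delete_first hk hN.dual (by simpa using hcl)
        (by simpa using hl) hone' hlastN
      · apply isMinor_of_dual
        rwa [dual_contract]
      -- Both ends fail only if the element of `N` is among the middle ones at each end; with `k`
      -- even this means `k = 4`, where `x 3` is itself the last element.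
      · have : k = 4 ∧ j ≠ 0 := by
          obtain h' | h' := h'
          · have := honly _ (by omega) h'
            grind
          · have := honly _ (by omega) h'
            grind
        obtain ⟨rfl, hj0⟩ := this
        exact hj3.resolve_left hj0
  · left
    have hrev := h.reverse_odd hp
    refine ⟨hrev.delete_first_isKConnected hM hk
      (by rw [IsAltFan.image_reverse]; exact hmax) hcyc, ?_⟩
    obtain h' | ⟨h', -⟩ := hrev.isMinor_delete_first hk hN hl hcl hone' hlastN
    · exact h'
    -- With `k` odd the element of `N` is the centre of a fan of length five. In `M ／ {x 3}` the
    -- elements `x 2` and `x 4` are parallel, so `x 4` can be deleted.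
    · have : k = 5 ∧ j = 2 := by
        obtain h' | h' := h'
        · have := honly _ (by omega) h'
          grind
        · have := honly _ (by omega) h'
          grind
      obtain ⟨rfl, rfl⟩ := this
      have ht2 := (h.isTriangle 2 (by omega) (by decide)).swap.swap_right
      have h1 := ht2.isMinor_contract_delete (hj3.resolve_left (by omega)) hlastN hl
      rw [contract_delete_comm _ (by
        simpa using h.ne (i := 3) (j := 4) (by omega) (by omega) (by omega))] at h1
      exact h1.trans (contract_isMinor _ _)

end Ends

/-! ### Fans and alternating fans -/

section Fans

variable {M : Matroid α} {k : ℕ}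

/-- In a 3-connected matroid with at least five elements no triangle is a triad. -/
lemma IsKConnected.not_isTriangle_and_isTriad [M.Finite] (hM : M.IsKConnected 3)
    (hE : 5 ≤ M.E.ncard) {a b c : α} (hT : M.IsTriangle {a, b, c}) :
    ¬ M.IsTriad {a, b, c} := by
  intro hK
  have h1 := hT.rk_le
  have h2 := IsTriangle.rk_le hK
  have h3 := M.rk_dual hT.subset_ground
  have h4 := ncard_sdiff_add_ncard_of_subset hT.subset_ground M.ground_finite
  have h5 := hT.ncard_eq
  have h6 := hM.le_rk_add hT.subset_ground (by omega) (by omega)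
  omega

lemma IsFan.of_dual {x : Fin k → α} (h : M✶.IsFan x) : M.IsFan x where
  three_le := h.three_le
  injective := h.injective
  mem_ground := h.mem_ground
  first := by
    have := h.first
    rw [dual_isTriad] at this
    exact this.symm
  triad_of_triangle i hi hT := h.triangle_of_triad i hi (dual_isTriad.2 hT)
  triangle_of_triad i hi hT := dual_isTriad.1 (h.triad_of_triangle i hi hT)

/-- `IsFan` constrains the successor of every triple that happens to be a triangle or a triad. With
five elements no triple is both, so the parity of its position decides. -/
lemma IsAltFan.isFan [M.Finite] (hM : M.IsKConnected 3) {y : ℕ → α} (h : M.IsAltFan k y)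
    (hk : 5 ≤ k) : M.IsFan (fun i : Fin k ↦ y i) := by
  have hE : 5 ≤ M.E.ncard := by
    refine hk.trans ?_
    rw [← h.ncard_image]
    exact ncard_le_ncard (h.image_subset_ground (by omega)) M.ground_finite
  refine ⟨by omega, fun i j hij ↦ Fin.ext (h.injOn i.2 j.2 hij),
    fun i ↦ h.mem_ground (by omega) i.2, .inl (h.isTriangle 0 (by omega) (by simp)), ?_, ?_⟩
  · intro i hi hT
    obtain hp | hp := Nat.even_or_odd i
    · exact h.isTriad (i + 1) hi hp.add_one
    · exact (hM.not_isTriangle_and_isTriad hE hT (h.isTriad i (by omega) hp)).elim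
  · intro i hi hT
    obtain hp | hp := Nat.even_or_odd i
    · exact (hM.not_isTriangle_and_isTriad hE (h.isTriangle i (by omega) hp) hT).elim
    · exact h.isTriangle (i + 1) hi hp.add_one

lemma IsFan.isAltFan {x : Fin k → α} (h : M.IsFan x) {y : ℕ → α} (hy : ∀ i : Fin k, y i = x i)
    (hT : M.IsTriangle (consecutiveTriple x 0 h.three_le)) : M.IsAltFan k y := by
  have htriple : ∀ i (hi : i + 2 < k), consecutiveTriple x i hi = {y i, y (i + 1), y (i + 2)} := by
    intro i hi
    rw [consecutiveTriple, ← hy, ← hy, ← hy]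
  have key : ∀ i (hi : i + 2 < k), (Even i → M.IsTriangle (consecutiveTriple x i hi)) ∧
      (Odd i → M.IsTriad (consecutiveTriple x i hi)) := by
    intro i
    induction i with
    | zero => exact fun _ ↦ ⟨fun _ ↦ hT, by simp⟩
    | succ i ih =>
      refine fun hi ↦ ⟨fun hp ↦ ?_, fun hp ↦ ?_⟩
      · exact h.triangle_of_triad i hi ((ih (by omega)).2 (by grind))
      · exact h.triad_of_triangle i hi ((ih (by omega)).1 (by grind))
  refine ⟨fun i hi j hj hij ↦ ?_, fun i hi hp ↦ htriple i hi ▸ (key i hi).1 hp,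
    fun i hi hp ↦ htriple i hi ▸ (key i hi).2 hp⟩
  rw [hy ⟨i, hi⟩, hy ⟨j, hj⟩] at hij
  exact congrArg Fin.val (h.injective hij)

lemma IsFan.dual {x : Fin k → α} (h : M.IsFan x) : M✶.IsFan x :=
  IsFan.of_dual (by rwa [dual_dual])

lemma image_Iio_eq_range {x : Fin k → α} {y : ℕ → α} (hy : ∀ i : Fin k, y i = x i) :
    y '' Iio k = range x := by
  ext z
  constructor
  · rintro ⟨i, hi, rfl⟩
    exact ⟨⟨i, hi⟩, (hy ⟨i, hi⟩).symm⟩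
  · rintro ⟨i, rfl⟩
    exact ⟨i, i.2, hy i⟩

/-- An alternating fan properly containing a fan of length at least four has at least five elements,
so `IsAltFan.isFan` makes it a genuine fan. -/
lemma IsMaximalFan.isAltMaximal [M.Finite] (hM : M.IsKConnected 3) {x : Fin k → α} (hk : 4 ≤ k)
    (hx : M.IsMaximalFan x) : M.IsAltMaximal (range x) := by
  intro m y hy hss
  have hm : 5 ≤ m := by
    have h1 := ncard_lt_ncard hss ((finite_Iio m).image y)
    have h2 : (range x).ncard = k := by
      rw [← image_univ, hx.1.injective.injOn.ncard_image, ncard_univ, Nat.card_fin]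
    have h3 : (y '' Iio m).ncard = m := by
      obtain h | h := hy <;> exact h.ncard_image
    omega
  have hfan : M.IsFan (fun i : Fin m ↦ y i) := by
    obtain h | h := hy
    · exact h.isFan hM hm
    · exact IsFan.of_dual (h.isFan hM.dual hm)
  have hrange := image_Iio_eq_range (x := fun i : Fin m ↦ y i) (y := y) fun _ ↦ rfl
  rw [hrange] at hss
  exact hss.ne (hx.2 m _ hfan hss.subset).symm

end Fans

end Matroid

/-! ### The theorem for arbitrary maximal fans -/

open Matroid in
theorem mainTheorem5 {α : Type*} (M N : Matroid α) (hfin : M.Finite)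
    (hM : M.IsKConnected 3) (hwheel : ¬ M.IsWheel) (hwhirl : ¬ M.IsWhirl)
    (hNM : N.IsMinor M) (hloop : ∀ e, ¬ N.IsLoop e) (hcoloop : ∀ e, ¬ N.IsColoop e)
    (k : ℕ) (hk : 4 ≤ k) (x : Fin k → α) (hx : M.IsMaximalFan x)
    (hNx : (N.E ∩ Set.range x).encard ≤ 1) :
    ((M.delete {x ⟨0, by omega⟩}).IsKConnected 3 ∧
        N.IsMinor (M.delete {x ⟨0, by omega⟩})) ∨
      ((M.contract {x ⟨0, by omega⟩}).IsKConnected 3 ∧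
        N.IsMinor (M.contract {x ⟨0, by omega⟩})) ∨
      ((M.delete {x ⟨k - 1, by omega⟩}).IsKConnected 3 ∧
        N.IsMinor (M.delete {x ⟨k - 1, by omega⟩})) ∨
      ((M.contract {x ⟨k - 1, by omega⟩}).IsKConnected 3 ∧
        N.IsMinor (M.contract {x ⟨k - 1, by omega⟩})) := by
  -- The default value from position `k` on is irrelevant: only the first `k` terms enter
  -- `IsAltFan`.
  obtain ⟨y, hy⟩ : ∃ y : ℕ → α, ∀ i : Fin k, y i = x i :=
    ⟨fun n ↦ if h : n < k then x ⟨n, h⟩ else x ⟨0, by omega⟩, fun i ↦ by simp⟩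
  have hmax : M.IsAltMaximal (y '' Set.Iio k) := by
    rw [image_Iio_eq_range hy]
    exact hx.isAltMaximal hM hk
  have hcyc : ¬ ∃ r φ, M.IsCyclicFan r φ := fun ⟨_, _, hφ⟩ ↦
    hφ.isWheel_or_isWhirl.elim hwheel hwhirl
  have hone : ∀ i < k, ∀ j < k, y i ∈ N.E → y j ∈ N.E → i = j := by
    intro i hi j hj hiN hjN
    rw [hy ⟨i, hi⟩] at hiN
    rw [hy ⟨j, hj⟩] at hjN
    exact congrArg Fin.val (hx.1.injective (Set.encard_le_one_iff.1 hNx _ _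
      ⟨hiN, Set.mem_range_self _⟩ ⟨hjN, Set.mem_range_self _⟩))
  rw [← hy, ← hy]
  obtain hT | hT := hx.1.first
  · have h := hx.1.isAltFan hy hT
    obtain h' | h' | h' :=
      h.exists_end_isKConnected_isMinor hM hk hmax hcyc hNM hloop hcoloop hone
    · exact .inl h'
    · exact .inr (.inr (.inl h'))
    · exact .inr (.inr (.inr h'))
  -- A fan that begins with a triad begins with a triangle in the dual, where deletion and
  -- contraction change places.
  · have h := hx.1.dual.isAltFan hy hT
    obtain ⟨h1, h2⟩ | ⟨h1, h2⟩ | ⟨h1, h2⟩ :=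
      h.exists_end_isKConnected_isMinor hM.dual hk hmax.dual
        (fun ⟨r, φ, hφ⟩ ↦ hcyc ⟨r, _, by simpa using hφ.dual⟩) hNM.dual
        (by simpa using hcoloop) (by simpa using hloop) hone
    · rw [← dual_contract] at h1 h2
      exact .inr (.inl ⟨isKConnected_of_dual h1, isMinor_of_dual h2⟩)
    · rw [← dual_contract] at h1 h2
      exact .inr (.inr (.inr ⟨isKConnected_of_dual h1, isMinor_of_dual h2⟩))
    · rw [← dual_delete] at h1 h2
      exact .inr (.inr (.inl ⟨isKConnected_of_dual h1, isMinor_of_dual h2⟩))
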